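/- **Setting.** Let $d\in\mathbb N$ and let $\Lambda\subset\mathbb Z^d$ be finite, with the Euclidean distance $|\cdot|$; write $x\sim y$ if $|x-y|=1$ and $B_r(x)=\{y\in\Lambda: |x-y|\le r\}$ for $x\in\Lambda$. On the bosonic Fock space over $\ell^2(\Lambda)$, with annihilation and creation operators $b_x,b_x^\dagger$, $n_x=b_x^\dagger b_x$ and $N_X=\sum_{x\in X}n_x$, consider the Bose–Hubbard type Hamiltonian $$H=\sum_{x,y\in\Lambda,\ x\sim y}\Big(J\,b_x^\dagger b_y+U\,n_x^{p/2}n_y^{p/2}-\mu\,(n_x+n_y)\Big),\qquad J,U,\mu\in\mathbb R,\ p\ge 1,$$ where the sum is over ordered pairs. For a density operator $\rho$ (a positive trace class operator with $\operatorname{Tr}\rho=1$) write $\langle A\rangle_t=\operatorname{Tr}\big[e^{itH}Ae^{-itH}\rho\big]$. We say that $\rho$ satisfies the controlled density assumption with parameters $\lambda>0$ and $\eta\ge1$ if $$\operatorname{Tr}\big[N_{B_r(x)}^{\zeta}\,\rho\big]\le(\lambda r^d)^{\zeta}\qquad\text{for all real } r\ge1,\ x\in\Lambda,\ 0<\zeta\le\eta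 .$$ **Theorem 3.1 (particle propagation bound).** Fix $d\in\mathbb N$, real numbers $\eta\ge1$ and $J$, $v>2d|J|$, $\delta_0\in(0,1)$ and $\beta\ge1$. There is a constant $C=C(d,\eta,J,v,\delta_0,\beta)>0$ such that for every finite $\Lambda\subset\mathbb Z^d$, all $U,\mu\in\mathbb R$ and $p\ge1$, every $\lambda>0$ and every density operator $\rho$ satisfying the controlled density assumption with parameters $\lambda$ and $\eta$, $$\big\langle N_{B_r(x)}^{\eta}\big\rangle_t\le C\,\operatorname{Tr}\big[N_{B_R(x)}^{\eta}\,\rho\big]+C\,\lambda^{\eta}\,(R-r)^{-\beta+d\eta}$$ for all $x\in\Lambda$, all $R>r\ge0$ with $R-r>\max\{1,\delta_0 r\}$, and all $t\in\mathbb R$ with $v|t|\le R-r$. In particular $C$ does not depend on $\Lambda$, $U$, $\mu$, $p$, $\lambda$ or $\rho$. -/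

import Mathlib

namespace BoseHubbard

noncomputable section

/-- Euclidean distance on the lattice `ℤ^d`. -/
def siteDist {d : ℕ} (x y : Fin d → ℤ) : ℝ :=
  √(∑ i, ((x i : ℝ) - (y i : ℝ)) ^ 2)

/-- Nearest neighbours `x ∼ y`, i.e. `|x - y| = 1`. -/
def Neighbor {d : ℕ} (x y : Fin d → ℤ) : Prop := siteDist x y = 1

open Classical in
/-- The ball `B_r(x) = {y ∈ Λ : |y - x| ≤ r}` inside the finite region `Λ ⊆ ℤ^d`. -/
def ball {d : ℕ} {Λ : Finset (Fin d → ℤ)} (x : Λ) (r : ℝ) : Finset Λ :=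
  Finset.univ.filter fun y : Λ => siteDist (y : Fin d → ℤ) x ≤ r

/-- Occupation numbers: `n x` is the number of bosons at the site `x ∈ Λ`. -/
abbrev Config {d : ℕ} (Λ : Finset (Fin d → ℤ)) : Type := Λ → ℕ

/-- Number of particles of the configuration `n` in `X ⊆ Λ`: the eigenvalue of
`N_X = ∑_{x ∈ X} n_x` at the occupation vector `|n⟩`. -/
def number {d : ℕ} {Λ : Finset (Fin d → ℤ)} (X : Finset Λ) (n : Config Λ) : ℕ :=
  ∑ x ∈ X, n x

/-- The configurations with exactly `N` particles. -/
abbrev Sector {d : ℕ} (Λ : Finset (Fin d → ℤ)) (N : ℕ) : Type :=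
  {n : Config Λ // number Finset.univ n = N}

instance {d : ℕ} (Λ : Finset (Fin d → ℤ)) (N : ℕ) : Finite (Sector Λ N) := by
  refine Finite.of_injective
    (fun (n : Sector Λ N) (x : Λ) => (⟨n.1 x, Nat.lt_succ_of_le ?_⟩ : Fin (N + 1))) ?_
  · have h : n.1 x ≤ ∑ y, n.1 y :=
      Finset.single_le_sum (fun _ _ => Nat.zero_le _) (Finset.mem_univ x)
    exact h.trans n.2.le
  · intro n m h
    ext x
    exact congrArg Fin.val (congrFun h x)

instance {d : ℕ} (Λ : Finset (Fin d → ℤ)) (N : ℕ) : Fintype (Sector Λ N) :=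
  Fintype.ofFinite _

/-- Bosonic Fock space over `ℓ²(Λ)`: the Hilbert direct sum over `N = 0, 1, 2, …` of the `N`-boson
spaces, where the `N`-boson space is written in its orthonormal basis of occupation vectors
`|n⟩`, `∑ₓ n x = N`. -/
abbrev Fock {d : ℕ} (Λ : Finset (Fin d → ℤ)) : Type :=
  lp (fun N : ℕ => EuclideanSpace ℂ (Sector Λ N)) 2

open Classical in
/-- The occupation vector `|n⟩`; these vectors form an orthonormal basis of Fock space. -/
def ket {d : ℕ} {Λ : Finset (Fin d → ℤ)} (n : Config Λ) : Fock Λ :=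
  lp.single 2 (number Finset.univ n) (EuclideanSpace.single ⟨n, rfl⟩ (1 : ℂ))

/-! Operators on the dense space of finite linear combinations of occupation vectors, on which
creation and annihilation operators and the Hamiltonian are defined. -/

/-- Finite linear combinations of occupation vectors (`Finsupp.single n 1` is `|n⟩`). -/
abbrev FinVec {d : ℕ} (Λ : Finset (Fin d → ℤ)) : Type := Config Λ →₀ ℂ

open Classical in
/-- Annihilation operator: `b_x |n⟩ = √(n x) |n - δ_x⟩` (which is `0` if `n x = 0`). -/
def annihilate {d : ℕ} {Λ : Finset (Fin d → ℤ)} (x : Λ) : FinVec Λ →ₗ[ℂ] FinVec Λ :=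
  Finsupp.linearCombination ℂ fun n : Config Λ =>
    Finsupp.single (n - Pi.single x 1) ((√(n x : ℝ) : ℝ) : ℂ)

open Classical in
/-- Creation operator: `b_x† |n⟩ = √(n x + 1) |n + δ_x⟩`. -/
def create {d : ℕ} {Λ : Finset (Fin d → ℤ)} (x : Λ) : FinVec Λ →ₗ[ℂ] FinVec Λ :=
  Finsupp.linearCombination ℂ fun n : Config Λ =>
    Finsupp.single (n + Pi.single x 1) ((√((n x : ℝ) + 1) : ℝ) : ℂ)

/-- The operator `f(n)` that is diagonal in the occupation basis: `f(n) |n⟩ = f n |n⟩`. -/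
def diagonal {d : ℕ} {Λ : Finset (Fin d → ℤ)} (f : Config Λ → ℝ) : FinVec Λ →ₗ[ℂ] FinVec Λ :=
  Finsupp.linearCombination ℂ fun n : Config Λ => Finsupp.single n ((f n : ℝ) : ℂ)

/-- `b_x† b_x` is the diagonal operator with eigenvalues `n x`, so that its powers are the diagonal
operators with eigenvalues `(n x)^a`. -/
theorem create_comp_annihilate_self {d : ℕ} {Λ : Finset (Fin d → ℤ)} (x : Λ) :
    create x ∘ₗ annihilate x = diagonal fun n : Config Λ => (n x : ℝ) := by
  classical
  refine Finsupp.lhom_ext' fun n => LinearMap.ext_ring ?_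
  simp only [create, annihilate, diagonal, LinearMap.comp_apply, Finsupp.lsingle_apply,
    Finsupp.linearCombination_single, one_smul]
  by_cases h : n x = 0
  · simp [h]
  · have h1 : n - Pi.single x 1 + Pi.single x 1 = n := by
      funext y
      by_cases hy : y = x
      · subst hy; simp; omega
      · simp [hy]
    have h2 : (((n - Pi.single x 1 : Config Λ) x : ℕ) : ℝ) + 1 = (n x : ℝ) := by
      have : (n - Pi.single x 1 : Config Λ) x + 1 = n x := by simp; omega
      exact_mod_cast this
    rw [h1, h2, Finsupp.smul_single, smul_eq_mul, ← Complex.ofReal_mul,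
      Real.mul_self_sqrt (Nat.cast_nonneg _)]

/-- Hopping term `T_{xy} = J b_x† b_y`. -/
def hopping {d : ℕ} {Λ : Finset (Fin d → ℤ)} (J : ℝ) (x y : Λ) : FinVec Λ →ₗ[ℂ] FinVec Λ :=
  (J : ℂ) • (create x ∘ₗ annihilate y)

/-- Potential term `V_{xy} = U n_x^{p/2} n_y^{p/2} - μ (n_x + n_y)`. -/
def potential {d : ℕ} {Λ : Finset (Fin d → ℤ)} (U μ p : ℝ) (x y : Λ) :
    FinVec Λ →ₗ[ℂ] FinVec Λ :=
  diagonal fun n : Config Λ =>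
    U * (n x : ℝ) ^ (p / 2) * (n y : ℝ) ^ (p / 2) - μ * ((n x : ℝ) + (n y : ℝ))

open Classical in
/-- Bose-Hubbard type Hamiltonian `H = ∑_{x, y ∈ Λ, x ∼ y} (T_{xy} + V_{xy})` (the sum is over
ordered pairs). -/
def hamiltonian {d : ℕ} (Λ : Finset (Fin d → ℤ)) (J U μ p : ℝ) : FinVec Λ →ₗ[ℂ] FinVec Λ :=
  ∑ x : Λ, ∑ y : Λ,
    if Neighbor (x : Fin d → ℤ) y then hopping J x y + potential U μ p x y else 0

/-- The matrix of `H` on the (finite-dimensional, `H`-invariant) `N`-particle space: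
`⟨n| H |m⟩` for `n, m` with `N` particles. -/
def sectorHamiltonian {d : ℕ} (Λ : Finset (Fin d → ℤ)) (J U μ p : ℝ) (N : ℕ) :
    Matrix (Sector Λ N) (Sector Λ N) ℂ :=
  Matrix.of fun n m => hamiltonian Λ J U μ p (Finsupp.single m.1 1) n.1

open Classical in
theorem hopping_apply {d : ℕ} {Λ : Finset (Fin d → ℤ)} (J : ℝ) (x y : Λ) (n m : Config Λ) :
    hopping J x y (Finsupp.single m 1) n =
      if m y ≠ 0 ∧ m - Pi.single y 1 + Pi.single x 1 = n then
        ((J * √(m y : ℝ) * √(n x : ℝ) : ℝ) : ℂ) else 0 := by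
  simp only [hopping, create, annihilate, LinearMap.comp_apply, LinearMap.smul_apply,
    Finsupp.linearCombination_single, one_smul, Finsupp.smul_single, smul_eq_mul]
  by_cases h0 : m y = 0
  · simp [h0]
  by_cases h : m - Pi.single y 1 + Pi.single x 1 = n
  · rw [if_pos ⟨h0, h⟩, h, Finsupp.single_eq_same]
    have hx : (n x : ℝ) = (((m - Pi.single y 1 : Config Λ) x : ℕ) : ℝ) + 1 := by
      rw [← h]; simp
    rw [hx, mul_assoc, Complex.ofReal_mul, Complex.ofReal_mul]
  · rw [if_neg (fun hh => h hh.2)]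
    exact Finsupp.single_eq_of_ne fun hh => h hh.symm

theorem hopping_symm {d : ℕ} {Λ : Finset (Fin d → ℤ)} (J : ℝ) (x y : Λ) (n m : Config Λ) :
    star (hopping J x y (Finsupp.single m 1) n) = hopping J y x (Finsupp.single n 1) m := by
  classical
  rw [hopping_apply, hopping_apply]
  have key : (m y ≠ 0 ∧ m - Pi.single y 1 + Pi.single x 1 = n) ↔
      (n x ≠ 0 ∧ n - Pi.single x 1 + Pi.single y 1 = m) := by
    constructor
    · rintro ⟨h, rfl⟩
      refine ⟨by simp, ?_⟩
      funext z
      by_cases hz : z = y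
      · subst hz; simp; omega
      · simp [hz]
    · rintro ⟨h, rfl⟩
      refine ⟨by simp, ?_⟩
      funext z
      by_cases hz : z = x
      · subst hz; simp; omega
      · simp [hz]
  by_cases h : n x ≠ 0 ∧ n - Pi.single x 1 + Pi.single y 1 = m
  · rw [if_pos h, if_pos (key.2 h)]
    simp [mul_right_comm]
  · rw [if_neg h, if_neg (fun hh => h (key.1 hh))]
    simp

theorem potential_symm {d : ℕ} {Λ : Finset (Fin d → ℤ)} (U μ p : ℝ) (x y : Λ) (n m : Config Λ) :
    star (potential U μ p x y (Finsupp.single m 1) n) =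
      potential U μ p y x (Finsupp.single n 1) m := by
  classical
  simp only [potential, diagonal, Finsupp.linearCombination_single, one_smul,
    Finsupp.single_apply]
  by_cases h : m = n
  · subst h
    simp only [if_true, RCLike.star_def, Complex.conj_ofReal]
    congr 1
    ring
  · simp [h, Ne.symm h]

theorem neighbor_comm {d : ℕ} (x y : Fin d → ℤ) : Neighbor x y ↔ Neighbor y x := by
  have : siteDist x y = siteDist y x := by
    unfold siteDist
    congr 1
    exact Finset.sum_congr rfl fun i _ => by ring
  rw [Neighbor, Neighbor, this]

theorem sectorHamiltonian_isHermitian {d : ℕ} (Λ : Finset (Fin d → ℤ)) (J U μ p : ℝ) (N : ℕ) :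
    (sectorHamiltonian Λ J U μ p N).IsHermitian := by
  classical
  ext n m
  simp only [sectorHamiltonian, hamiltonian, Matrix.conjTranspose_apply, Matrix.of_apply,
    LinearMap.sum_apply, Finsupp.finsetSum_apply, star_sum]
  rw [Finset.sum_comm]
  refine Finset.sum_congr rfl fun x _ => Finset.sum_congr rfl fun y _ => ?_
  by_cases h : Neighbor (x : Fin d → ℤ) y
  · rw [if_pos h, if_pos ((neighbor_comm _ _).1 h)]
    simp only [LinearMap.add_apply, Finsupp.add_apply, star_add]
    rw [hopping_symm, potential_symm]
  · rw [if_neg h, if_neg (fun hh => h ((neighbor_comm _ _).1 hh))]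
    simp

/-- `H` conserves the particle number: `⟨n| H |m⟩ ≠ 0` only if `n` and `m` have equally many
particles. -/
theorem hamiltonian_conserves_number {d : ℕ} (Λ : Finset (Fin d → ℤ)) (J U μ p : ℝ)
    (n m : Config Λ) (h : hamiltonian Λ J U μ p (Finsupp.single m 1) n ≠ 0) :
    number Finset.univ n = number Finset.univ m := by
  classical
  contrapose! h
  simp only [hamiltonian, LinearMap.sum_apply, Finsupp.finsetSum_apply]
  refine Finset.sum_eq_zero fun x _ => Finset.sum_eq_zero fun y _ => ?_
  by_cases hxy : Neighbor (x : Fin d → ℤ) y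
  swap
  · rw [if_neg hxy]; simp
  rw [if_pos hxy, LinearMap.add_apply, Finsupp.add_apply, hopping_apply]
  have hmn : n ≠ m := fun hh => h (by rw [hh])
  have hV : potential U μ p x y (Finsupp.single m 1) n = 0 := by
    simp only [potential, diagonal, Finsupp.linearCombination_single, one_smul]
    exact Finsupp.single_eq_of_ne hmn
  rw [hV, add_zero, if_neg]
  rintro ⟨hy, rfl⟩
  apply h
  have h1 : m - Pi.single y 1 + Pi.single y 1 = m := by
    funext z
    by_cases hz : z = y
    · subst hz; simp; omega
    · simp [hz]
  have h2 : number Finset.univ m = number Finset.univ (m - Pi.single y 1 + Pi.single y 1) := by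
    rw [h1]
  rw [h2]
  simp [number, Finset.sum_add_distrib]

open Classical in
/-- The matrix of `e^{-i t H}` on the `N`-particle space. -/
def sectorEvolution {d : ℕ} (Λ : Finset (Fin d → ℤ)) (J U μ p t : ℝ) (N : ℕ) :
    Matrix (Sector Λ N) (Sector Λ N) ℂ :=
  NormedSpace.exp ((-(Complex.I * (t : ℂ))) • sectorHamiltonian Λ J U μ p N)

open Classical in
theorem sectorEvolution_isometry {d : ℕ} (Λ : Finset (Fin d → ℤ)) (J U μ p t : ℝ) (N : ℕ)
    (ψ : EuclideanSpace ℂ (Sector Λ N)) :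
    ‖Matrix.toEuclideanLin (sectorEvolution Λ J U μ p t N) ψ‖ = ‖ψ‖ := by
  have hU : (sectorEvolution Λ J U μ p t N).conjTranspose * sectorEvolution Λ J U μ p t N = 1 := by
    unfold sectorEvolution
    rw [← Matrix.exp_conjTranspose, Matrix.conjTranspose_smul,
      (sectorHamiltonian_isHermitian Λ J U μ p N).eq]
    have : star (-(Complex.I * (t : ℂ))) = -(-(Complex.I * (t : ℂ))) := by simp
    rw [this, neg_smul, Matrix.exp_neg]
    exact Matrix.nonsing_inv_mul _ ((Matrix.isUnit_iff_isUnit_det _).1 (Matrix.isUnit_exp _))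
  have h2 : inner ℂ (Matrix.toEuclideanLin (sectorEvolution Λ J U μ p t N) ψ)
      (Matrix.toEuclideanLin (sectorEvolution Λ J U μ p t N) ψ) = inner ℂ ψ ψ := by
    rw [← LinearMap.adjoint_inner_left, ← Matrix.toEuclideanLin_conjTranspose_eq_adjoint]
    congr 1
    simp [Matrix.toLpLin_apply, Matrix.mulVec_mulVec, hU]
  rw [inner_self_eq_norm_sq_to_K, inner_self_eq_norm_sq_to_K] at h2
  have h3 : ‖Matrix.toEuclideanLin (sectorEvolution Λ J U μ p t N) ψ‖ ^ 2 = ‖ψ‖ ^ 2 := by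
    exact_mod_cast h2
  exact (sq_eq_sq₀ (norm_nonneg _) (norm_nonneg _)).1 h3

open Classical in
/-- The unitary propagator `e^{-i t H}` on Fock space: the direct sum of its restrictions to the
`N`-particle spaces. -/
def propagator {d : ℕ} (Λ : Finset (Fin d → ℤ)) (J U μ p t : ℝ) : Fock Λ →L[ℂ] Fock Λ :=
  LinearIsometry.toContinuousLinearMap
    { toFun := fun ψ => ⟨fun N => Matrix.toEuclideanLin (sectorEvolution Λ J U μ p t N) (ψ N), by
        have h := lp.memℓp ψ
        refine memℓp_gen ?_
        simp_rw [sectorEvolution_isometry]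
        exact h.summable (by norm_num)⟩
      map_add' := fun ψ φ => by
        ext N : 2
        exact map_add (Matrix.toEuclideanLin (sectorEvolution Λ J U μ p t N)) (ψ N) (φ N)
      map_smul' := fun c ψ => by
        ext N : 2
        exact map_smul (Matrix.toEuclideanLin (sectorEvolution Λ J U μ p t N)) c (ψ N)
      norm_map' := fun ψ => by
        rw [lp.norm_eq_tsum_rpow (by norm_num), lp.norm_eq_tsum_rpow (by norm_num)]
        congr 1
        exact tsum_congr fun N => by
          congr 1
          exact sectorEvolution_isometry Λ J U μ p t N (ψ N) }

/-- The time-evolved state `e^{-i t H} ρ e^{i t H}`. -/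
def evolve {d : ℕ} {Λ : Finset (Fin d → ℤ)} (J U μ p t : ℝ) (ρ : Fock Λ →L[ℂ] Fock Λ) :
    Fock Λ →L[ℂ] Fock Λ :=
  propagator Λ J U μ p t ∘L ρ ∘L propagator Λ J U μ p (-t)

/-- The trace `Tr[f(n) σ] ∈ [0, ∞]` of a positive operator `σ` against the nonnegative operator
`f(n)` that is diagonal in the occupation basis, computed in that basis. -/
def traceDiag {d : ℕ} {Λ : Finset (Fin d → ℤ)} (f : Config Λ → ℝ) (σ : Fock Λ →L[ℂ] Fock Λ) :
    ENNReal :=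
  ∑' n : Config Λ, ENNReal.ofReal (f n * (inner ℂ (ket n) (σ (ket n))).re)

/-- A state (density operator): a positive trace class operator of trace one. -/
structure IsState {d : ℕ} {Λ : Finset (Fin d → ℤ)} (ρ : Fock Λ →L[ℂ] Fock Λ) : Prop where
  isPositive : ρ.IsPositive
  trace_eq_one : traceDiag (fun _ => 1) ρ = 1

/-- `Tr[N_X^ζ σ]`, for a positive operator `σ`. -/
def moment {d : ℕ} {Λ : Finset (Fin d → ℤ)} (X : Finset Λ) (ζ : ℝ) (σ : Fock Λ →L[ℂ] Fock Λ) :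
    ENNReal :=
  traceDiag (fun n => (number X n : ℝ) ^ ζ) σ

/-- Controlled density: `Tr[N_{B_r(x)}^ζ ρ] ≤ (lam r^d)^ζ` for all `r ≥ 1`, `x ∈ Λ` and
`0 < ζ ≤ η`. -/
def ControlledDensity {d : ℕ} {Λ : Finset (Fin d → ℤ)} (lam η : ℝ)
    (ρ : Fock Λ →L[ℂ] Fock Λ) : Prop :=
  ∀ r : ℝ, 1 ≤ r → ∀ x : Λ, ∀ ζ : ℝ, 0 < ζ → ζ ≤ η →
    moment (ball x r) ζ ρ ≤ ENNReal.ofReal ((lam * r ^ d) ^ ζ)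

end

end BoseHubbard

/-! The proof follows one time-dependent observable whose expectation never increases. Let `D y` be
the distance from `y` to the centre `x`, let `f_s(y)` be the logistic function at `a * (w - u * s -
D y)`, and let `S_s = ∑ f_s(y) n_y`: a smoothed particle number in a ball whose radius `w - u * s`
shrinks at a speed `u` strictly between `2d|J|` and `v`. The potential is diagonal, hence commutes
with `S_s ^ η`, and so `U`, `μ`, `p` drop out. A nearest-neighbour hop changes `S_s` by a difference
of two values of `f_s`. The derivative of the logistic function is `σ (1 - σ)`, and its increments
over steps of size at most `a` are bounded by `(exp a - 1) σ (1 - σ)` (`abs_sigmoid_sub_le`). Hence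
the commutator with `H` (`sum_norm_commutator_le`) and the explicit time derivative are both
controlled by the same diagonal operator `η S^(η-1) ∑ f (1 - f) n_y`, with constants `2d|J| (exp a -
1) exp(a (η - 1))` and `-a u`. For small `a` the second wins (`exists_slope`), with no remainder to
iterate; this gives `sum_weightedNumber_rpow_evolution_le`.

That bound concerns vectors with fixed particle number. It passes to states because the propagator
and all diagonal observables respect the sectors, and each sector block of a positive operator is a
finite sum of rank-one positive matrices (`exists_sector_decomposition`).

With `w = r + u * |t|`, the cutoff at the final time is at least `1/2` on `B_r(x)`. At time zero it
is at most `1` on `B_R(x)` and exponentially small outside, since `u * |t|` is at most a fixed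
fraction of `R - r`. Jensen's inequality with exponential weights reduces the tail to single-site
moments, which the controlled density assumption bounds (`traceDiag_weightedNumber_sigmoid_le`); the
exponential gain beats any power of `R - r`. -/

namespace BoseHubbard

/-! ### Logistic cutoffs -/

/-- This is why the cutoff is logistic: the increment is bounded by the derivative at one endpoint,
tails included, so the commutator can be absorbed in the time derivative without error. -/
theorem abs_sigmoid_sub_le {u v h : ℝ} (huv : |v - u| ≤ h) :
    |Real.sigmoid v - Real.sigmoid u| ≤
      (Real.exp h - 1) * (Real.sigmoid u * (1 - Real.sigmoid u)) := by
  rw [abs_le] at huv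
  have hE : 0 < Real.exp (-u) := Real.exp_pos _
  have hg : 0 < Real.exp (u - v) := Real.exp_pos _
  have hv : Real.exp (-v) = Real.exp (-u) * Real.exp (u - v) := by
    rw [← Real.exp_add]; congr 1; ring
  have hg1 : Real.exp (u - v) ≤ Real.exp h := Real.exp_le_exp.2 (by linarith)
  have hg2 : 1 ≤ Real.exp h * Real.exp (u - v) := by
    rw [← Real.exp_add]; exact Real.one_le_exp (by linarith)
  rw [Real.sigmoid_def, Real.sigmoid_def, hv]
  generalize Real.exp (-u) = E at *
  generalize Real.exp (u - v) = g at *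
  generalize Real.exp h = q at *
  have h1 : (1 + E * g)⁻¹ - (1 + E)⁻¹ = E * (1 - g) / ((1 + E) * (1 + E * g)) := by
    field_simp; ring
  have h2 : (q - 1) * ((1 + E)⁻¹ * (1 - (1 + E)⁻¹)) =
      (q - 1) * (1 + E * g) * E / ((1 + E) * (1 + E * g) * (1 + E)) := by
    field_simp; ring
  have h3 : E * (1 - g) / ((1 + E) * (1 + E * g)) =
      (1 - g) * (1 + E) * E / ((1 + E) * (1 + E * g) * (1 + E)) := by
    field_simp
  -- AM-GM from `q * g ≥ 1`. For `g ≤ 1` it gives `1 - g ≤ q - 1`, and `q * g ≥ 1` gives `1 - g ≤ (q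
  -- - 1) * g`; together these bound `(1 - g) * (1 + E)`.
  have hq : 2 ≤ q + g := by nlinarith [sq_nonneg (q - g)]
  have hEg := mul_pos hE hg
  rw [h1, h2, h3, abs_div, abs_of_pos (a := (1 + E) * (1 + E * g) * (1 + E)) (by positivity)]
  gcongr
  rw [abs_mul, abs_of_pos hE]
  gcongr
  rw [abs_mul, abs_of_pos (a := 1 + E) (by positivity)]
  rcases le_total 1 g with hg' | hg'
  · rw [abs_of_nonpos (by linarith)]
    nlinarith [mul_nonneg hE.le (sub_nonneg.2 hg')]
  · rw [abs_of_nonneg (by linarith)]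
    nlinarith

theorem sigmoid_le_exp_mul {u v h : ℝ} (huv : |v - u| ≤ h) :
    Real.sigmoid v ≤ Real.exp h * Real.sigmoid u := by
  have h1 := (abs_le.1 (abs_sigmoid_sub_le huv)).2
  have h2 : 1 ≤ Real.exp h := Real.one_le_exp ((abs_nonneg _).trans huv)
  nlinarith [Real.sigmoid_pos u, Real.sigmoid_le_one u,
    mul_nonneg (sub_nonneg.2 h2) (sq_nonneg (Real.sigmoid u))]

theorem sigmoid_le_exp (u : ℝ) : Real.sigmoid u ≤ Real.exp u := by
  rw [Real.sigmoid_def, ← neg_neg u, Real.exp_neg (-u), neg_neg]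
  exact inv_anti₀ (Real.exp_pos _) (by linarith)

/-! ### Differences of powers -/

/-- The tangent line of the convex power function at `B`, in the form of Bernoulli's inequality for
`A / B`. -/
theorem rpow_sub_rpow_le {A B η : ℝ} (hA : 0 < A) (hB : 0 < B) (hη : 1 ≤ η) :
    B ^ η - A ^ η ≤ η * B ^ (η - 1) * (B - A) := by
  have h := one_add_mul_self_le_rpow_one_add (s := A / B - 1) (by
    have : 0 < A / B := by positivity
    linarith) hη
  rw [add_sub_cancel, Real.div_rpow hA.le hB.le, le_div_iff₀ (by positivity)] at h
  have h2 : B ^ η = B ^ (η - 1) * B := by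
    rw [← Real.rpow_add_one hB.ne']; congr 1; ring
  have h3 : (1 + η * (A / B - 1)) * B ^ η = B ^ η + η * B ^ (η - 1) * (A - B) := by
    rw [h2]; field_simp
  rw [h3] at h
  linarith

theorem abs_rpow_sub_rpow_le {A B M η : ℝ} (hA : 0 < A) (hB : 0 < B) (hη : 1 ≤ η)
    (hAM : A ^ (η - 1) ≤ M) (hBM : B ^ (η - 1) ≤ M) :
    |B ^ η - A ^ η| ≤ η * M * |B - A| := by
  rcases le_total A B with h | h
  · rw [abs_of_nonneg (sub_nonneg.2 (Real.rpow_le_rpow hA.le h (by linarith))),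
      abs_of_nonneg (sub_nonneg.2 h)]
    refine (rpow_sub_rpow_le hA hB hη).trans ?_
    gcongr
  · rw [abs_sub_comm, abs_sub_comm B,
      abs_of_nonneg (sub_nonneg.2 (Real.rpow_le_rpow hB.le h (by linarith))),
      abs_of_nonneg (sub_nonneg.2 h)]
    refine (rpow_sub_rpow_le hB hA hη).trans ?_
    gcongr

/-- The weighted AM-GM bound on one matrix element of the commutator of a hopping term with a
power of a weighted particle number. -/
theorem hop_amgm {A B q η k l a b : ℝ} (hA : 0 < A) (hB : 0 < B) (hη : 1 ≤ η) (hq : 1 ≤ q)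
    (hAB : A ≤ q * B) (hBA : B ≤ q * A) (hk : 0 ≤ k) (hl : 0 ≤ l) :
    √k * √l * |B ^ η - A ^ η| * a * b ≤
      η * q ^ (η - 1) * |B - A| * ((k * A ^ (η - 1) * a ^ 2 + l * B ^ (η - 1) * b ^ 2) / 2) := by
  have hη' : 0 ≤ η - 1 := by linarith
  have hQ : 1 ≤ q ^ (η - 1) := Real.one_le_rpow hq hη'
  have hA' : 0 < A ^ (η - 1) := by positivity
  have hB' : 0 < B ^ (η - 1) := by positivity
  have hAB' : A ^ (η - 1) ≤ q ^ (η - 1) * B ^ (η - 1) := by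
    rw [← Real.mul_rpow (by linarith) hB.le]; exact Real.rpow_le_rpow hA.le hAB hη'
  have hBA' : B ^ (η - 1) ≤ q ^ (η - 1) * A ^ (η - 1) := by
    rw [← Real.mul_rpow (by linarith) hA.le]; exact Real.rpow_le_rpow hB.le hBA hη'
  -- Up to the factor `q ^ (η - 1)`, `M` can be replaced by the power of either `A` or `B`, so each
  -- square is paired with the power belonging to its own configuration.
  obtain ⟨M, hM⟩ : ∃ M, M = max (A ^ (η - 1)) (B ^ (η - 1)) := ⟨_, rfl⟩
  have hMA : M ≤ q ^ (η - 1) * A ^ (η - 1) :=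
    hM ▸ max_le (le_mul_of_one_le_left hA'.le hQ) hBA'
  have hMB : M ≤ q ^ (η - 1) * B ^ (η - 1) :=
    hM ▸ max_le hAB' (le_mul_of_one_le_left hB'.le hQ)
  have hM0 : 0 ≤ M := hM ▸ hA'.le.trans (le_max_left _ _)
  have h1 := abs_rpow_sub_rpow_le hA hB hη (hM ▸ le_max_left _ _) (hM ▸ le_max_right _ _)
  have hkl : √k * √l * a * b ≤ (k * a ^ 2 + l * b ^ 2) / 2 := by
    nlinarith [sq_nonneg (√k * a - √l * b), Real.sq_sqrt hk, Real.sq_sqrt hl]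
  have hkl' : |√k * √l * a * b| ≤ (k * a ^ 2 + l * b ^ 2) / 2 := by
    refine abs_le.2 ⟨?_, hkl⟩
    nlinarith [sq_nonneg (√k * a + √l * b), Real.sq_sqrt hk, Real.sq_sqrt hl]
  calc √k * √l * |B ^ η - A ^ η| * a * b = |B ^ η - A ^ η| * (√k * √l * a * b) := by ring
    _ ≤ |B ^ η - A ^ η| * |√k * √l * a * b| := by gcongr; exact le_abs_self _
    _ ≤ (η * M * |B - A|) * ((k * a ^ 2 + l * b ^ 2) / 2) := by gcongr
    _ = η * |B - A| * ((M * (k * a ^ 2) + M * (l * b ^ 2)) / 2) := by ring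
    _ ≤ η * |B - A| * ((q ^ (η - 1) * A ^ (η - 1) * (k * a ^ 2) +
          q ^ (η - 1) * B ^ (η - 1) * (l * b ^ 2)) / 2) := by gcongr
    _ = _ := by ring

/-! ### Monotone observables along a unitary evolution -/

theorem hasDerivAt_exp_smul_mulVec {S : Type*} [Fintype S] [DecidableEq S] (H : Matrix S S ℂ)
    (c : ℂ) (φ : S → ℂ) (s : ℝ) (n : S) :
    HasDerivAt (fun s : ℝ => (NormedSpace.exp ((c * (s : ℂ)) • H)).mulVec φ n)
      (c * ∑ m, H n m * (NormedSpace.exp ((c * (s : ℂ)) • H)).mulVec φ m) s := by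
  let _ : NormedRing (Matrix S S ℂ) := Matrix.linftyOpNormedRing
  let _ : NormedAlgebra ℂ (Matrix S S ℂ) := Matrix.linftyOpNormedAlgebra
  have h0 := hasDerivAt_exp_smul_const' (𝕂 := ℂ) H (c * (s : ℂ))
  let L : Matrix S S ℂ →ₗ[ℂ] ℂ :=
    { toFun := fun M => M.mulVec φ n
      map_add' := fun M N => by simp [Matrix.add_mulVec]
      map_smul' := fun a M => by simp [Matrix.smul_mulVec] }
  have h1 := (LinearMap.toContinuousLinearMap L).hasFDerivAt.comp_hasDerivAt _ h0
  have h2 : HasDerivAt (fun s : ℝ => c * (s : ℂ)) c s := by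
    simpa using (Complex.ofRealCLM.hasDerivAt (x := s)).const_mul c
  have h3 := h1.scomp s h2
  have h4 : (H * NormedSpace.exp ((c * (s : ℂ)) • H)).mulVec φ n =
      ∑ m, H n m * (NormedSpace.exp ((c * (s : ℂ)) • H)).mulVec φ m := by
    rw [← Matrix.mulVec_mulVec]; rfl
  rw [← h4]
  exact h3

/-- Heisenberg's equation in coordinates: the commutator of a diagonal `F` with `H` has entries of
modulus `‖H n m‖ * |F m - F n|`, and `hbound` says that the decrease of `F` dominates it. The real
`σ` allows both time directions. -/
theorem antitone_sum_mul_normSq {S : Type*} [Fintype S] {H : Matrix S S ℂ} (hH : H.IsHermitian)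
    {σ : ℝ} (hσ : |σ| ≤ 1) {ψ : ℝ → S → ℂ}
    (hψ : ∀ s n, HasDerivAt (fun s => ψ s n) (-(Complex.I * σ) * ∑ m, H n m * ψ s m) s)
    {F F' : ℝ → S → ℝ} (hF : ∀ s n, HasDerivAt (fun s => F s n) (F' s n) s)
    (hbound : ∀ s, ∀ φ : S → ℂ, ∑ n, ∑ m, ‖H n m‖ * |F s m - F s n| * ‖φ m‖ * ‖φ n‖ ≤
      ∑ n, -F' s n * ‖φ n‖ ^ 2) :
    Antitone fun s => ∑ n, F s n * ‖ψ s n‖ ^ 2 := by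
  have hd : ∀ s, HasDerivAt (fun s => ∑ n, F s n * ‖ψ s n‖ ^ 2)
      (∑ n, (F' s n * ‖ψ s n‖ ^ 2 + F s n *
        (2 * inner ℝ (ψ s n) (-(Complex.I * σ) * ∑ m, H n m * ψ s m)))) s := fun s =>
    HasDerivAt.fun_sum fun n _ => (hF s n).mul (hψ s n).norm_sq
  refine antitone_of_deriv_nonpos (fun s => (hd s).differentiableAt) fun s => ?_
  rw [(hd s).deriv]
  let z : S → S → ℝ := fun n m =>
    (starRingEnd ℂ (ψ s n) * (-(Complex.I * σ) * (H n m * ψ s m))).re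
  have hz : ∀ n m, z m n = -z n m := fun n m => by
    have : starRingEnd ℂ (ψ s m) * (-(Complex.I * σ) * (H m n * ψ s n)) =
        -starRingEnd ℂ (starRingEnd ℂ (ψ s n) * (-(Complex.I * σ) * (H n m * ψ s m))) := by
      rw [← hH.apply m n]
      simp
      ring
    simp only [z]
    rw [this, Complex.neg_re, Complex.conj_re]
  have hzn : ∀ n m, |z n m| ≤ ‖H n m‖ * ‖ψ s m‖ * ‖ψ s n‖ := fun n m => by
    refine (Complex.abs_re_le_norm _).trans ?_
    simp only [norm_mul, RCLike.norm_conj, norm_neg, Complex.norm_I, Complex.norm_real,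
      Real.norm_eq_abs, one_mul]
    calc ‖ψ s n‖ * (|σ| * (‖H n m‖ * ‖ψ s m‖)) ≤ ‖ψ s n‖ * (1 * (‖H n m‖ * ‖ψ s m‖)) := by
          gcongr
      _ = _ := by ring
  have hin : ∀ n, inner ℝ (ψ s n) (-(Complex.I * σ) * ∑ m, H n m * ψ s m) = ∑ m, z n m := by
    intro n
    rw [Complex.inner, Finset.mul_sum, Finset.sum_mul, Complex.re_sum]
    exact Finset.sum_congr rfl fun m _ => by rw [mul_comm]
  -- The probability current `z` is antisymmetric because `H` is Hermitian, so symmetrising the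
  -- double sum leaves only differences of `F`.
  have h1 : ∑ n, F s n * (2 * ∑ m, z n m) = ∑ n, ∑ m, (F s n - F s m) * z n m := by
    have e1 : ∑ n, ∑ m, F s m * z n m = -∑ n, ∑ m, F s n * z n m := by
      rw [Finset.sum_comm, ← Finset.sum_neg_distrib]
      refine Finset.sum_congr rfl fun n _ => ?_
      rw [← Finset.sum_neg_distrib]
      exact Finset.sum_congr rfl fun m _ => by rw [hz n m]; ring
    simp only [sub_mul, Finset.sum_sub_distrib]
    rw [e1]
    simp only [Finset.mul_sum, ← Finset.sum_add_distrib, sub_neg_eq_add]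
    exact Finset.sum_congr rfl fun n _ => Finset.sum_congr rfl fun m _ => by ring
  simp only [hin, Finset.sum_add_distrib]
  rw [h1]
  have h2 : ∑ n, ∑ m, (F s n - F s m) * z n m ≤
      ∑ n, ∑ m, ‖H n m‖ * |F s m - F s n| * ‖ψ s m‖ * ‖ψ s n‖ := by
    refine Finset.sum_le_sum fun n _ => Finset.sum_le_sum fun m _ => ?_
    calc (F s n - F s m) * z n m ≤ |F s n - F s m| * |z n m| := by
          rw [← abs_mul]; exact le_abs_self _
      _ ≤ |F s n - F s m| * (‖H n m‖ * ‖ψ s m‖ * ‖ψ s n‖) := by gcongr; exact hzn n m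
      _ = _ := by rw [abs_sub_comm]; ring
  have h3 := hbound s (ψ s)
  simp only [neg_mul, Finset.sum_neg_distrib] at h3
  linarith

/-! ### The lattice -/

theorem siteDist_eq_dist {d : ℕ} (x y : Fin d → ℤ) :
    siteDist x y = dist (WithLp.toLp 2 fun i => (x i : ℝ) : EuclideanSpace ℝ (Fin d))
      (WithLp.toLp 2 fun i => (y i : ℝ)) := by
  rw [EuclideanSpace.dist_eq]
  simp [siteDist, Real.dist_eq]

theorem siteDist_nonneg {d : ℕ} (x y : Fin d → ℤ) : 0 ≤ siteDist x y := Real.sqrt_nonneg _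

theorem abs_siteDist_sub_le {d : ℕ} (x y z : Fin d → ℤ) :
    |siteDist x z - siteDist y z| ≤ siteDist x y := by
  simp only [siteDist_eq_dist]
  exact abs_dist_sub_le _ _ _

theorem abs_sub_le_siteDist {d : ℕ} (x y : Fin d → ℤ) (i : Fin d) :
    |(x i : ℝ) - y i| ≤ siteDist x y := by
  rw [← Real.sqrt_sq_eq_abs]
  exact Real.sqrt_le_sqrt (Finset.single_le_sum (f := fun i => ((x i : ℝ) - y i) ^ 2)
    (fun _ _ => sq_nonneg _) (Finset.mem_univ i))

/-- A sum of integer squares equal to `1` has exactly one nonzero term. This yields the count `2 *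
d` of neighbours, the source of the critical speed `2d|J|`. -/
theorem exists_eq_add_single_of_neighbor {d : ℕ} {x y : Fin d → ℤ} (h : Neighbor x y) :
    ∃ i : Fin d, ∃ s : Bool, y = x + Pi.single i (if s then 1 else -1) := by
  have h1 : ∑ i, (x i - y i) ^ 2 = 1 := by
    have h2 : (∑ i, ((x i : ℝ) - (y i : ℝ)) ^ 2) = 1 := by
      rw [Neighbor, siteDist, Real.sqrt_eq_one] at h
      exact h
    exact_mod_cast h2
  obtain ⟨i, hi⟩ : ∃ i, x i - y i ≠ 0 := by
    by_contra! hc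
    simp [hc] at h1
  have hi1 : 1 ≤ (x i - y i) ^ 2 := by
    have := sq_pos_of_ne_zero hi
    omega
  have hsplit := Finset.add_sum_erase Finset.univ (fun i => (x i - y i) ^ 2) (Finset.mem_univ i)
  have hnn : 0 ≤ ∑ j ∈ Finset.univ.erase i, (x j - y j) ^ 2 :=
    Finset.sum_nonneg fun _ _ => sq_nonneg _
  have hz : ∑ j ∈ Finset.univ.erase i, (x j - y j) ^ 2 = 0 := by
    linarith
  have hone : (x i - y i) ^ 2 = 1 := by
    linarith
  have hj : ∀ j, j ≠ i → y j = x j := fun j hj => by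
    have := (Finset.sum_eq_zero_iff_of_nonneg fun _ _ => sq_nonneg _).1 hz j
      (Finset.mem_erase.2 ⟨hj, Finset.mem_univ j⟩)
    have := pow_eq_zero_iff (two_ne_zero) |>.1 this
    omega
  refine ⟨i, decide (x i - y i = -1), ?_⟩
  funext j
  by_cases hji : j = i
  · subst hji
    rcases (sq_eq_sq_iff_eq_or_eq_neg (b := (1 : ℤ))).1 (by rw [hone, one_pow]) with h | h
    · simp [h]; omega
    · simp [h]; omega
  · simp [hji, hj j hji]

open Classical in
theorem card_neighbor_le {d : ℕ} {Λ : Finset (Fin d → ℤ)} (x : Λ) :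
    (Finset.univ.filter fun y : Λ => Neighbor (x : Fin d → ℤ) y).card ≤ 2 * d := by
  have h : ((Finset.univ.filter fun y : Λ => Neighbor (x : Fin d → ℤ) y).map
      (Function.Embedding.subtype _)) ⊆ (Finset.univ : Finset (Fin d × Bool)).image
        fun p => (x : Fin d → ℤ) + Pi.single p.1 (if p.2 then 1 else -1) := by
    intro y hy
    obtain ⟨y', hy', rfl⟩ := Finset.mem_map.1 hy
    obtain ⟨i, s, hs⟩ := exists_eq_add_single_of_neighbor (Finset.mem_filter.1 hy').2
    exact Finset.mem_image.2 ⟨(i, s), Finset.mem_univ _, hs.symm⟩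
  have h2 := (Finset.card_le_card h).trans Finset.card_image_le
  rw [Finset.card_map] at h2
  refine h2.trans ?_
  simp [mul_comm]

/-! ### Weighted particle numbers and the hopping terms -/

/-- Eigenvalue of `∑ₓ f(x) n_x` at `|n⟩`. -/
def weightedNumber {d : ℕ} {Λ : Finset (Fin d → ℤ)} (f : Λ → ℝ) (n : Config Λ) : ℝ :=
  ∑ x, f x * n x

open Classical in
/-- The configuration `n` arises from `m` when a particle hops from `y` to `x`. -/
def IsHop {d : ℕ} {Λ : Finset (Fin d → ℤ)} (x y : Λ) (n m : Config Λ) : Prop :=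
  m y ≠ 0 ∧ m - Pi.single y 1 + Pi.single x 1 = n

/-- A form free of truncated subtraction, to which additive functionals can be applied. -/
theorem IsHop.add_single {d : ℕ} {Λ : Finset (Fin d → ℤ)} [DecidableEq Λ] {x y : Λ}
    {n m : Config Λ} (h : IsHop x y n m) : n + Pi.single y 1 = m + Pi.single x 1 := by
  obtain ⟨h0, rfl⟩ := h
  funext z
  by_cases hz : z = y
  · subst hz
    simp
    by_cases hx : z = x
    · subst hx; simp; omega
    · simp [hx]; omega
  · by_cases hx : z = x
    · subst hx; simp [hz]
    · simp [hx, hz]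

theorem IsHop.symm {d : ℕ} {Λ : Finset (Fin d → ℤ)} {x y : Λ} {n m : Config Λ}
    (h : IsHop x y n m) : IsHop y x m n := by
  classical
  obtain ⟨h0, rfl⟩ := h
  refine ⟨by simp, ?_⟩
  funext z
  by_cases hz : z = y
  · subst hz; simp; omega
  · simp [hz]

theorem weightedNumber_nonneg {d : ℕ} {Λ : Finset (Fin d → ℤ)} {f : Λ → ℝ} (hf : ∀ x, 0 ≤ f x)
    (n : Config Λ) : 0 ≤ weightedNumber f n :=
  Finset.sum_nonneg fun x _ => mul_nonneg (hf x) (Nat.cast_nonneg _)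

theorem le_weightedNumber {d : ℕ} {Λ : Finset (Fin d → ℤ)} {f : Λ → ℝ} (hf : ∀ x, 0 ≤ f x)
    {n : Config Λ} {x : Λ} (h : n x ≠ 0) : f x ≤ weightedNumber f n := by
  have h1 : f x * n x ≤ weightedNumber f n :=
    Finset.single_le_sum (f := fun x => f x * (n x : ℝ))
      (fun x _ => mul_nonneg (hf x) (Nat.cast_nonneg _)) (Finset.mem_univ x)
  have h2 : (1 : ℝ) ≤ n x := by exact_mod_cast Nat.one_le_iff_ne_zero.2 h
  nlinarith [hf x]

theorem IsHop.weightedNumber_eq {d : ℕ} {Λ : Finset (Fin d → ℤ)} {x y : Λ} {n m : Config Λ}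
    (h : IsHop x y n m) (f : Λ → ℝ) :
    weightedNumber f n = weightedNumber f m + (f x - f y) := by
  classical
  have h1 := congrArg (weightedNumber f) h.add_single
  have h2 : ∀ (k : Config Λ) (z : Λ),
      weightedNumber f (k + Pi.single z 1) = weightedNumber f k + f z := fun k z => by
    simp [weightedNumber, mul_add, Finset.sum_add_distrib, Pi.single_apply]
  rw [h2, h2] at h1
  linarith

/-- The hop adds `f x - f y ≤ (q - 1) * f y`, and the particle sitting at `y` before the hop already
contributes `f y` to the weighted number. -/
theorem IsHop.weightedNumber_le {d : ℕ} {Λ : Finset (Fin d → ℤ)} {x y : Λ} {n m : Config Λ}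
    (h : IsHop x y n m) {f : Λ → ℝ} (hf : ∀ x, 0 ≤ f x) {q : ℝ} (hq : 1 ≤ q)
    (hxy : f x ≤ q * f y) : weightedNumber f n ≤ q * weightedNumber f m := by
  have h1 := le_weightedNumber hf h.1
  rw [h.weightedNumber_eq f]
  nlinarith

open Classical in
-- The potential only contributes for `n = m`, where the difference of `F` vanishes; the bound is
-- therefore independent of `U`, `μ` and `p`.
theorem norm_sectorHamiltonian_mul_le {d : ℕ} {Λ : Finset (Fin d → ℤ)} (J U μ p : ℝ) (N : ℕ)
    (F : Config Λ → ℝ) (n m : Sector Λ N) :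
    ‖sectorHamiltonian Λ J U μ p N n m‖ * |F m.1 - F n.1| ≤
      ∑ x : Λ, ∑ y : Λ, if Neighbor (x : Fin d → ℤ) y ∧ IsHop x y n.1 m.1 then
        |J| * (√(m.1 y : ℝ) * √(n.1 x : ℝ) * |F m.1 - F n.1|) else 0 := by
  by_cases hnm : n = m
  · subst hnm
    simp
  have hnm' : n.1 ≠ m.1 := fun h => hnm (Subtype.ext h)
  simp only [sectorHamiltonian, hamiltonian, Matrix.of_apply, LinearMap.sum_apply,
    Finsupp.finsetSum_apply]
  refine (mul_le_mul_of_nonneg_right (norm_sum_le _ _) (abs_nonneg _)).trans ?_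
  rw [Finset.sum_mul]
  refine Finset.sum_le_sum fun x _ => ?_
  refine (mul_le_mul_of_nonneg_right (norm_sum_le _ _) (abs_nonneg _)).trans ?_
  rw [Finset.sum_mul]
  refine Finset.sum_le_sum fun y _ => ?_
  by_cases hxy : Neighbor (x : Fin d → ℤ) y
  swap
  · simp [hxy]
  have hV : potential U μ p x y (Finsupp.single m.1 1) n.1 = 0 := by
    simp only [potential, diagonal, Finsupp.linearCombination_single, one_smul]
    exact Finsupp.single_eq_of_ne hnm'
  rw [if_pos hxy, LinearMap.add_apply, Finsupp.add_apply, hV, add_zero, hopping_apply]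
  by_cases hh : IsHop x y n.1 m.1
  · rw [if_pos (show m.1 y ≠ 0 ∧ _ from hh), if_pos ⟨hxy, hh⟩, Complex.norm_real, Real.norm_eq_abs, abs_mul,
      abs_mul, abs_of_nonneg (Real.sqrt_nonneg _), abs_of_nonneg (Real.sqrt_nonneg _)]
    exact le_of_eq (by ring)
  · rw [if_neg (show ¬(m.1 y ≠ 0 ∧ _) from hh), if_neg (fun h => hh h.2)]
    simp

open Classical in
theorem sum_ite_le_of_unique {S : Type*} [Fintype S] {P : S → Prop} {a : ℝ} (ha : 0 ≤ a)
    (hP : ∀ i j, P i → P j → i = j) : ∑ i, (if P i then a else 0) ≤ a := by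
  by_cases h : ∃ i, P i
  · obtain ⟨i, hi⟩ := h
    rw [Finset.sum_eq_single i (fun j _ hj => if_neg fun hh => hj (hP j i hh hi)) (by simp),
      if_pos hi]
  · push Not at h
    simp [h, ha]

open Classical in
/-- The commutator of the Hamiltonian with a power of a weighted particle number is bounded, as a
form, by a diagonal operator. -/
theorem sum_norm_commutator_le {d : ℕ} {Λ : Finset (Fin d → ℤ)} (J U μ p : ℝ) (N : ℕ)
    {f : Λ → ℝ} (hf : ∀ x, 0 < f x) {q η : ℝ} (hq : 1 ≤ q) (hη : 1 ≤ η)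
    (hfq : ∀ x y : Λ, Neighbor (x : Fin d → ℤ) y → f x ≤ q * f y) (φ : Sector Λ N → ℂ) :
    ∑ n, ∑ m, ‖sectorHamiltonian Λ J U μ p N n m‖ *
        |weightedNumber f m.1 ^ η - weightedNumber f n.1 ^ η| * ‖φ m‖ * ‖φ n‖ ≤
      ∑ n : Sector Λ N, (|J| * (η * q ^ (η - 1)) * (weightedNumber f n.1 ^ (η - 1) *
        ∑ x : Λ, n.1 x * ∑ y : Λ, if Neighbor (x : Fin d → ℤ) y then |f x - f y| else 0)) *
          ‖φ n‖ ^ 2 := by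
  let c : Λ → Λ → ℝ := fun x y =>
    if Neighbor (x : Fin d → ℤ) y then |J| * (η * q ^ (η - 1)) * |f x - f y| else 0
  let g : Sector Λ N → Λ → ℝ := fun n x =>
    n.1 x * weightedNumber f n.1 ^ (η - 1) * ‖φ n‖ ^ 2
  have hf0 : ∀ x, 0 ≤ f x := fun x => (hf x).le
  have hg : ∀ n x, 0 ≤ g n x := fun n x => by
    have := weightedNumber_nonneg hf0 n.1
    positivity
  have hc : ∀ x y, 0 ≤ c x y := fun x y => by
    simp only [c]
    split_ifs <;> positivity
  have hcs : ∀ x y, c x y = c y x := fun x y => by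
    simp only [c, neighbor_comm (x : Fin d → ℤ) y, abs_sub_comm (f x)]
  have key : ∀ n m : Sector Λ N, ‖sectorHamiltonian Λ J U μ p N n m‖ *
        |weightedNumber f m.1 ^ η - weightedNumber f n.1 ^ η| * ‖φ m‖ * ‖φ n‖ ≤
      ∑ x : Λ, ∑ y : Λ, c x y / 2 * ((if IsHop x y n.1 m.1 then g n x else 0) +
        (if IsHop x y n.1 m.1 then g m y else 0)) := by
    intro n m
    refine (mul_le_mul_of_nonneg_right (mul_le_mul_of_nonneg_right
      (norm_sectorHamiltonian_mul_le J U μ p N (fun n => weightedNumber f n ^ η) n m)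
      (norm_nonneg _)) (norm_nonneg _)).trans ?_
    simp only [Finset.sum_mul]
    refine Finset.sum_le_sum fun x _ => Finset.sum_le_sum fun y _ => ?_
    by_cases hxy : Neighbor (x : Fin d → ℤ) y
    swap
    · simp [hxy, c]
    by_cases hh : IsHop x y n.1 m.1
    swap
    · simp [hh]
    rw [if_pos ⟨hxy, hh⟩, if_pos hh, if_pos hh]
    simp only [c, if_pos hxy, g]
    have hn := (hf x).trans_le (le_weightedNumber hf0 hh.symm.1)
    have hm := (hf y).trans_le (le_weightedNumber hf0 hh.1)
    have h := hop_amgm hn hm hη hq (hh.weightedNumber_le hf0 hq (hfq x y hxy))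
      (hh.symm.weightedNumber_le hf0 hq (hfq y x ((neighbor_comm _ _).1 hxy)))
      (Nat.cast_nonneg (n.1 x)) (Nat.cast_nonneg (m.1 y)) (a := ‖φ n‖) (b := ‖φ m‖)
    have e : |weightedNumber f m.1 - weightedNumber f n.1| = |f x - f y| := by
      rw [hh.weightedNumber_eq f, abs_sub_comm]
      congr 1
      ring
    rw [e] at h
    calc _ = |J| * (√(n.1 x : ℝ) * √(m.1 y : ℝ) *
          |weightedNumber f m.1 ^ η - weightedNumber f n.1 ^ η| * ‖φ n‖ * ‖φ m‖) := by ring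
      _ ≤ _ := mul_le_mul_of_nonneg_left h (abs_nonneg J)
      _ = _ := by ring
  -- For fixed `x` and `y`, either end of a hop determines the other, so each configuration is
  -- counted at most once.
  have hA : ∀ x y : Λ, ∑ n : Sector Λ N, ∑ m : Sector Λ N,
      (if IsHop x y n.1 m.1 then g n x else 0) ≤ ∑ n, g n x := fun x y =>
    Finset.sum_le_sum fun n _ => sum_ite_le_of_unique (hg n x) fun i j hi hj =>
      Subtype.ext (hi.symm.2.symm.trans hj.symm.2)
  have hB : ∀ x y : Λ, ∑ n : Sector Λ N, ∑ m : Sector Λ N,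
      (if IsHop x y n.1 m.1 then g m y else 0) ≤ ∑ n, g n y := fun x y => by
    rw [Finset.sum_comm]
    exact Finset.sum_le_sum fun m _ => sum_ite_le_of_unique (hg m y) fun i j hi hj =>
      Subtype.ext (hi.2.symm.trans hj.2)
  calc _ ≤ ∑ n : Sector Λ N, ∑ m : Sector Λ N, ∑ x : Λ, ∑ y : Λ, c x y / 2 *
          ((if IsHop x y n.1 m.1 then g n x else 0) +
            (if IsHop x y n.1 m.1 then g m y else 0)) :=
        Finset.sum_le_sum fun n _ => Finset.sum_le_sum fun m _ => key n m
    _ = ∑ x : Λ, ∑ y : Λ, c x y / 2 *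
          ((∑ n : Sector Λ N, ∑ m : Sector Λ N, (if IsHop x y n.1 m.1 then g n x else 0)) +
            ∑ n : Sector Λ N, ∑ m : Sector Λ N, (if IsHop x y n.1 m.1 then g m y else 0)) := by
        simp only [← Finset.sum_add_distrib, Finset.mul_sum]
        simp only [Finset.sum_comm (s := (Finset.univ : Finset (Sector Λ N)))
          (t := (Finset.univ : Finset Λ))]
    _ ≤ ∑ x : Λ, ∑ y : Λ, c x y / 2 * (∑ n, g n x + ∑ n, g n y) :=
        Finset.sum_le_sum fun x _ => Finset.sum_le_sum fun y _ =>
          mul_le_mul_of_nonneg_left (add_le_add (hA x y) (hB x y)) (by linarith [hc x y])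
    _ = ∑ x : Λ, ∑ y : Λ, c x y * ∑ n, g n x := by
        have h1 : ∑ x : Λ, ∑ y : Λ, c x y * ∑ n, g n y = ∑ x : Λ, ∑ y : Λ, c x y * ∑ n, g n x := by
          rw [Finset.sum_comm]
          exact Finset.sum_congr rfl fun x _ => Finset.sum_congr rfl fun y _ => by rw [hcs]
        have h2 : ∀ x y, c x y / 2 * (∑ n, g n x + ∑ n, g n y) =
            (c x y * ∑ n, g n x) / 2 + (c x y * ∑ n, g n y) / 2 := fun x y => by ring
        simp only [h2, Finset.sum_add_distrib, ← Finset.sum_div]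
        rw [h1]
        ring
    _ = _ := by
        simp only [Finset.mul_sum, Finset.sum_mul]
        rw [Finset.sum_congr rfl fun x _ => Finset.sum_comm, Finset.sum_comm]
        refine Finset.sum_congr rfl fun n _ => Finset.sum_congr rfl fun x _ =>
          Finset.sum_congr rfl fun y _ => ?_
        simp only [c, g]
        split_ifs <;> ring

open Classical in
theorem sum_neighbor_abs_sub_le {d : ℕ} {Λ : Finset (Fin d → ℤ)} {f : Λ → ℝ} {b : Λ → ℝ}
    (hb : ∀ x y : Λ, Neighbor (x : Fin d → ℤ) y → |f x - f y| ≤ b x) (x : Λ) (hx : 0 ≤ b x) :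
    (∑ y : Λ, if Neighbor (x : Fin d → ℤ) y then |f x - f y| else 0) ≤ 2 * d * b x := by
  rw [← Finset.sum_filter]
  refine (Finset.sum_le_card_nsmul _ _ (b x) fun y hy => hb x y (Finset.mem_filter.1 hy).2).trans ?_
  rw [nsmul_eq_mul]
  gcongr
  exact_mod_cast card_neighbor_le x

/-! ### Propagation in a sector of fixed particle number -/

theorem hasDerivAt_weightedNumber_sigmoid_rpow {d : ℕ} {Λ : Finset (Fin d → ℤ)} {η : ℝ}
    (hη : 1 ≤ η) (a u w : ℝ) (D : Λ → ℝ) (n : Config Λ) (s : ℝ) :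
    HasDerivAt (fun s => weightedNumber (fun x => Real.sigmoid (a * (w - u * s - D x))) n ^ η)
      ((∑ x, Real.sigmoid (a * (w - u * s - D x)) * (1 - Real.sigmoid (a * (w - u * s - D x))) *
        (-(a * u)) * n x) * η *
          weightedNumber (fun x => Real.sigmoid (a * (w - u * s - D x))) n ^ (η - 1)) s := by
  refine HasDerivAt.rpow_const ?_ (Or.inr hη)
  refine HasDerivAt.fun_sum fun x _ => HasDerivAt.mul_const ?_ _
  have h : HasDerivAt (fun s => a * (w - u * s - D x)) (-(a * u)) s := by
    have := ((((hasDerivAt_id s).const_mul u).const_sub w).sub_const (D x)).const_mul a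
    simpa using this
  exact (Real.hasDerivAt_sigmoid _).comp s h

theorem sum_weightedNumber_rpow_evolution_le {d : ℕ} {Λ : Finset (Fin d → ℤ)}
    (J U μ p : ℝ) (N : ℕ) {η a u : ℝ} (hη : 1 ≤ η) (ha : 0 ≤ a)
    (hau : 2 * d * |J| * ((Real.exp a - 1) * Real.exp a ^ (η - 1)) ≤ a * u)
    {D : Λ → ℝ} (hD : ∀ x y : Λ, Neighbor (x : Fin d → ℤ) y → |D x - D y| ≤ 1)
    (w t : ℝ) (φ : Sector Λ N → ℂ) :
    ∑ n : Sector Λ N,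
        weightedNumber (fun x => Real.sigmoid (a * (w - u * |t| - D x))) n.1 ^ η *
          ‖(sectorEvolution Λ J U μ p t N).mulVec φ n‖ ^ 2 ≤
      ∑ n : Sector Λ N,
        weightedNumber (fun x => Real.sigmoid (a * (w - D x))) n.1 ^ η * ‖φ n‖ ^ 2 := by
  classical
  -- `σ` is the sign of `t`: the clock `s` runs from `0` to `|t|` and the generator carries the
  -- sign.
  obtain ⟨σ, hσ, hσt⟩ : ∃ σ : ℝ, |σ| ≤ 1 ∧ σ * |t| = t := by
    rcases le_total 0 t with h | h
    · exact ⟨1, by simp, by simp [abs_of_nonneg h]⟩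
    · exact ⟨-1, by simp, by simp [abs_of_nonpos h]⟩
  have hanti := antitone_sum_mul_normSq (sectorHamiltonian_isHermitian Λ J U μ p N) hσ
    (ψ := fun s => (NormedSpace.exp ((-(Complex.I * σ) * (s : ℂ)) •
      sectorHamiltonian Λ J U μ p N)).mulVec φ)
    (fun s n => hasDerivAt_exp_smul_mulVec _ _ φ s n)
    (F := fun s n => weightedNumber (fun x => Real.sigmoid (a * (w - u * s - D x))) n.1 ^ η)
    (fun s n => hasDerivAt_weightedNumber_sigmoid_rpow hη a u w D n.1 s) ?_
  · have h := hanti (abs_nonneg t)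
    have e1 : (-(Complex.I * σ) * ((|t| : ℝ) : ℂ)) = -(Complex.I * (t : ℂ)) := by
      conv_rhs => rw [← hσt]
      push_cast
      ring
    simp only [e1, Complex.ofReal_zero, mul_zero, zero_smul, NormedSpace.exp_zero,
      Matrix.one_mulVec, sub_zero] at h
    exact h
  · intro s χ
    set f : Λ → ℝ := fun x => Real.sigmoid (a * (w - u * s - D x))
    have hdist : ∀ x y : Λ, Neighbor (x : Fin d → ℤ) y →
        |a * (w - u * s - D y) - a * (w - u * s - D x)| ≤ a := fun x y hxy => by
      have : a * (w - u * s - D y) - a * (w - u * s - D x) = a * (D x - D y) := by ring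
      rw [this, abs_mul, abs_of_nonneg ha]
      exact mul_le_of_le_one_right ha (hD x y hxy)
    have hq : 1 ≤ Real.exp a := Real.one_le_exp ha
    have hb0 : ∀ x, 0 ≤ f x * (1 - f x) := fun x =>
      mul_nonneg (Real.sigmoid_nonneg _) (sub_nonneg.2 (Real.sigmoid_le_one _))
    refine (sum_norm_commutator_le J U μ p N (f := f) (fun x => Real.sigmoid_pos _) hq hη
      (fun x y hxy => sigmoid_le_exp_mul (hdist y x ((neighbor_comm _ _).1 hxy))) χ).trans ?_
    refine Finset.sum_le_sum fun n _ => mul_le_mul_of_nonneg_right ?_ (by positivity)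
    have hS : 0 ≤ weightedNumber f n.1 ^ (η - 1) :=
      Real.rpow_nonneg (weightedNumber_nonneg (fun x => Real.sigmoid_nonneg _) _) _
    have hsum : (∑ x : Λ, (n.1 x : ℝ) *
        ∑ y : Λ, if Neighbor (x : Fin d → ℤ) y then |f x - f y| else 0) ≤
          2 * d * (Real.exp a - 1) * ∑ x : Λ, f x * (1 - f x) * n.1 x := by
      rw [Finset.mul_sum]
      refine Finset.sum_le_sum fun x _ => ?_
      have h := sum_neighbor_abs_sub_le (f := f)
        (b := fun x => (Real.exp a - 1) * (f x * (1 - f x)))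
        (fun x y hxy => by rw [abs_sub_comm]; exact abs_sigmoid_sub_le (hdist x y hxy)) x
        (mul_nonneg (by linarith) (hb0 x))
      calc _ ≤ (n.1 x : ℝ) * (2 * d * ((Real.exp a - 1) * (f x * (1 - f x)))) :=
            mul_le_mul_of_nonneg_left h (Nat.cast_nonneg _)
        _ = _ := by ring
    have hG : 0 ≤ ∑ x : Λ, f x * (1 - f x) * n.1 x :=
      Finset.sum_nonneg fun x _ => mul_nonneg (hb0 x) (Nat.cast_nonneg _)
    calc _ ≤ |J| * (η * Real.exp a ^ (η - 1)) * (weightedNumber f n.1 ^ (η - 1) *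
          (2 * d * (Real.exp a - 1) * ∑ x : Λ, f x * (1 - f x) * n.1 x)) := by gcongr
      _ = (2 * d * |J| * ((Real.exp a - 1) * Real.exp a ^ (η - 1))) *
          (η * weightedNumber f n.1 ^ (η - 1) * ∑ x : Λ, f x * (1 - f x) * n.1 x) := by ring
      -- The slope condition `hau` is used here: the commutator is dominated by the drift of the
      -- shrinking cutoff.
      _ ≤ (a * u) *
          (η * weightedNumber f n.1 ^ (η - 1) * ∑ x : Λ, f x * (1 - f x) * n.1 x) := by gcongr
      _ = _ := by
        have : ∑ x : Λ, f x * (1 - f x) * (-(a * u)) * n.1 x =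
            -(a * u) * ∑ x : Λ, f x * (1 - f x) * n.1 x := by
          rw [Finset.mul_sum]
          exact Finset.sum_congr rfl fun x _ => by ring
        rw [this]
        ring

/-! ### Reduction from Fock space to the sectors -/

open Classical in
theorem ket_eq_single {d : ℕ} {Λ : Finset (Fin d → ℤ)} {N : ℕ} (k : Sector Λ N) :
    ket k.1 = lp.single 2 N (EuclideanSpace.single k (1 : ℂ)) := by
  obtain ⟨k, rfl⟩ := k
  rfl

theorem inner_ket {d : ℕ} {Λ : Finset (Fin d → ℤ)} {N : ℕ} (k : Sector Λ N) (φ : Fock Λ) :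
    inner ℂ (ket k.1) φ = φ N k := by
  classical
  rw [ket_eq_single, lp.inner_single_left, EuclideanSpace.inner_single_left]
  simp

open Classical in
theorem propagator_ket {d : ℕ} {Λ : Finset (Fin d → ℤ)} (J U μ p t : ℝ) {N : ℕ}
    (l : Sector Λ N) :
    propagator Λ J U μ p t (ket l.1) = ∑ k, sectorEvolution Λ J U μ p t N k l • ket k.1 := by
  simp only [ket_eq_single, ← lp.single_smul]
  ext M k
  change Matrix.toEuclideanLin (sectorEvolution Λ J U μ p t M)
    (lp.single (E := fun N : ℕ => EuclideanSpace ℂ (Sector Λ N)) 2 N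
      (EuclideanSpace.single l (1 : ℂ)) M) k = _
  rw [lp.coeFn_sum, Finset.sum_apply]
  by_cases h : M = N
  · subst h
    simp [Matrix.toLpLin_apply, Pi.single_apply]
  · simp [Matrix.toLpLin_apply, Pi.single_eq_of_ne h]

theorem sectorEvolution_neg {d : ℕ} (Λ : Finset (Fin d → ℤ)) (J U μ p t : ℝ) (N : ℕ) :
    sectorEvolution Λ J U μ p (-t) N = (sectorEvolution Λ J U μ p t N).conjTranspose := by
  unfold sectorEvolution
  rw [← Matrix.exp_conjTranspose, Matrix.conjTranspose_smul,
    (sectorHamiltonian_isHermitian Λ J U μ p N).eq]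
  simp

/-- The `N`-particle block of an operator on Fock space. -/
noncomputable def sectorBlock {d : ℕ} {Λ : Finset (Fin d → ℤ)} (ρ : Fock Λ →L[ℂ] Fock Λ) (N : ℕ) :
    Matrix (Sector Λ N) (Sector Λ N) ℂ :=
  Matrix.of fun k l => inner ℂ (ket k.1) (ρ (ket l.1))

open scoped ComplexOrder in
theorem sectorBlock_posSemidef {d : ℕ} {Λ : Finset (Fin d → ℤ)} {ρ : Fock Λ →L[ℂ] Fock Λ}
    (hρ : ρ.IsPositive) (N : ℕ) : (sectorBlock ρ N).PosSemidef := by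
  refine .of_dotProduct_mulVec_nonneg ?_ fun c => ?_
  · ext k l
    simp only [sectorBlock, Matrix.conjTranspose_apply, Matrix.of_apply, RCLike.star_def,
      inner_conj_symm]
    exact hρ.isSymmetric _ _
  · have h := hρ.inner_nonneg_right (∑ k, c k • ket k.1)
    simp only [map_sum, map_smul, sum_inner, inner_sum, inner_smul_left, inner_smul_right] at h
    simp only [Finset.mul_sum] at h
    rw [Finset.sum_comm] at h
    convert h using 1
    simp only [dotProduct, Matrix.mulVec, sectorBlock, Matrix.of_apply, Finset.mul_sum,
      Pi.star_apply, RCLike.star_def]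
    exact Finset.sum_congr rfl fun k _ => Finset.sum_congr rfl fun l _ => by ring

open Classical in
theorem inner_ket_evolve {d : ℕ} {Λ : Finset (Fin d → ℤ)} (J U μ p t : ℝ)
    (ρ : Fock Λ →L[ℂ] Fock Λ) {N : ℕ} (n : Sector Λ N) :
    inner ℂ (ket n.1) (evolve J U μ p t ρ (ket n.1)) =
      (sectorEvolution Λ J U μ p t N * sectorBlock ρ N *
        (sectorEvolution Λ J U μ p t N).conjTranspose) n n := by
  rw [inner_ket]
  change Matrix.toEuclideanLin (sectorEvolution Λ J U μ p t N)
    (ρ (propagator Λ J U μ p (-t) (ket n.1)) N) n = _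
  have h : ∀ k, ρ (propagator Λ J U μ p (-t) (ket n.1)) N k =
      (sectorBlock ρ N * (sectorEvolution Λ J U μ p t N).conjTranspose) k n := fun k => by
    rw [← inner_ket, propagator_ket, map_sum, inner_sum, Matrix.mul_apply, sectorEvolution_neg]
    refine Finset.sum_congr rfl fun l _ => ?_
    rw [map_smul, inner_smul_right, mul_comm]
    rfl
  rw [Matrix.mul_assoc, Matrix.mul_apply, Matrix.toLpLin_apply]
  exact Finset.sum_congr rfl fun k _ => by rw [← h]

/-- The `N`-particle block of a state is an incoherent mixture of vectors, which evolve under the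
sector propagators. -/
theorem exists_sector_decomposition {d : ℕ} {Λ : Finset (Fin d → ℤ)} {ρ : Fock Λ →L[ℂ] Fock Λ}
    (hρ : ρ.IsPositive) (N : ℕ) :
    ∃ (m : ℕ) (φ : Fin m → Sector Λ N → ℂ),
      (∀ n : Sector Λ N, (inner ℂ (ket n.1) (ρ (ket n.1))).re = ∑ i, ‖φ i n‖ ^ 2) ∧
      ∀ J U μ p t : ℝ, ∀ n : Sector Λ N,
        (inner ℂ (ket n.1) (evolve J U μ p t ρ (ket n.1))).re =
          ∑ i, ‖(sectorEvolution Λ J U μ p t N).mulVec (φ i) n‖ ^ 2 := by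
  classical
  obtain ⟨m, φ, h⟩ := Matrix.posSemidef_iff_eq_sum_vecMulVec.1 (sectorBlock_posSemidef hρ N)
  have hre : ∀ z : ℂ, (z * star z).re = ‖z‖ ^ 2 := fun z => by
    rw [RCLike.star_def, Complex.mul_conj, Complex.normSq_eq_norm_sq, Complex.ofReal_re]
  refine ⟨m, φ, fun n => ?_, fun J U μ p t n => ?_⟩
  · change (sectorBlock ρ N n n).re = _
    rw [h, Matrix.sum_apply, Complex.re_sum]
    exact Finset.sum_congr rfl fun i _ => hre _
  · rw [inner_ket_evolve, h, Matrix.mul_sum, Matrix.sum_mul, Matrix.sum_apply, Complex.re_sum]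
    refine Finset.sum_congr rfl fun i _ => ?_
    rw [Matrix.mul_vecMulVec, Matrix.vecMulVec_mul, ← Matrix.star_mulVec, Matrix.vecMulVec_apply]
    exact hre _

theorem re_inner_ket_nonneg {d : ℕ} {Λ : Finset (Fin d → ℤ)} {ρ : Fock Λ →L[ℂ] Fock Λ}
    (hρ : ρ.IsPositive) (n : Config Λ) : 0 ≤ (inner ℂ (ket n) (ρ (ket n))).re := by
  obtain ⟨m, φ, h, -⟩ := exists_sector_decomposition hρ (number Finset.univ n)
  have := h ⟨n, rfl⟩
  simp only at this
  rw [this]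
  positivity

theorem re_inner_ket_evolve_nonneg {d : ℕ} {Λ : Finset (Fin d → ℤ)} {ρ : Fock Λ →L[ℂ] Fock Λ}
    (hρ : ρ.IsPositive) (J U μ p t : ℝ) (n : Config Λ) :
    0 ≤ (inner ℂ (ket n) (evolve J U μ p t ρ (ket n))).re := by
  obtain ⟨m, φ, -, h⟩ := exists_sector_decomposition hρ (number Finset.univ n)
  have := h J U μ p t ⟨n, rfl⟩
  simp only at this
  rw [this]
  positivity

theorem traceDiag_eq_tsum_sector {d : ℕ} {Λ : Finset (Fin d → ℤ)} (f : Config Λ → ℝ)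
    (ρ : Fock Λ →L[ℂ] Fock Λ) :
    traceDiag f ρ = ∑' N : ℕ, ∑ n : Sector Λ N,
      ENNReal.ofReal (f n.1 * (inner ℂ (ket n.1) (ρ (ket n.1))).re) := by
  rw [traceDiag, ← (Equiv.sigmaFiberEquiv (number (Λ := Λ) Finset.univ)).tsum_eq,
    ENNReal.tsum_sigma']
  exact tsum_congr fun N => tsum_fintype _

theorem traceDiag_weightedNumber_evolve_le {d : ℕ} {Λ : Finset (Fin d → ℤ)}
    {ρ : Fock Λ →L[ℂ] Fock Λ} (hρ : ρ.IsPositive)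
    (J U μ p : ℝ) {η a u : ℝ} (hη : 1 ≤ η) (ha : 0 ≤ a)
    (hau : 2 * d * |J| * ((Real.exp a - 1) * Real.exp a ^ (η - 1)) ≤ a * u)
    {D : Λ → ℝ} (hD : ∀ x y : Λ, Neighbor (x : Fin d → ℤ) y → |D x - D y| ≤ 1) (w t : ℝ) :
    traceDiag
        (fun n => weightedNumber (fun x => Real.sigmoid (a * (w - u * |t| - D x))) n ^ η)
        (evolve J U μ p t ρ) ≤
      traceDiag (fun n => weightedNumber (fun x => Real.sigmoid (a * (w - D x))) n ^ η) ρ := by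
  rw [traceDiag_eq_tsum_sector, traceDiag_eq_tsum_sector]
  refine ENNReal.tsum_le_tsum fun N => ?_
  have hpow : ∀ (g : Λ → ℝ) (n : Config Λ),
      0 ≤ weightedNumber (fun x => Real.sigmoid (g x)) n ^ η := fun g n =>
    Real.rpow_nonneg (weightedNumber_nonneg (fun x => Real.sigmoid_nonneg _) _) _
  rw [← ENNReal.ofReal_sum_of_nonneg
      fun n _ => mul_nonneg (hpow _ _) (re_inner_ket_evolve_nonneg hρ J U μ p t _),
    ← ENNReal.ofReal_sum_of_nonneg
      fun n _ => mul_nonneg (hpow _ _) (re_inner_ket_nonneg hρ _)]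
  refine ENNReal.ofReal_le_ofReal ?_
  obtain ⟨m, φ, h0, h1⟩ := exists_sector_decomposition hρ N
  simp only [h0, h1, Finset.mul_sum]
  rw [Finset.sum_comm, Finset.sum_comm (t := (Finset.univ : Finset (Fin m)))]
  exact Finset.sum_le_sum fun i _ =>
    sum_weightedNumber_rpow_evolution_le J U μ p N hη ha hau hD w t (φ i)

/-! ### Exponential sums -/

theorem summable_exp_neg_mul_abs_int {c : ℝ} (hc : 0 < c) :
    Summable fun k : ℤ => Real.exp (-c * |(k : ℝ)|) := by
  have h : Summable fun n : ℕ => Real.exp (-c * (n : ℝ)) := by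
    have h1 : ∀ n : ℕ, Real.exp (-c * (n : ℝ)) = Real.exp (-c) ^ n := fun n => by
      rw [← Real.exp_nat_mul]; congr 1; ring
    simp only [h1]
    exact summable_geometric_of_lt_one (Real.exp_pos _).le (Real.exp_lt_one_iff.2 (by linarith))
  exact Summable.of_nat_of_neg (by simpa using h) (by simpa using h)

theorem exists_sum_exp_neg_siteDist_le (d : ℕ) {c : ℝ} (hc : 0 < c) :
    ∃ W : ℝ, 0 < W ∧ ∀ (Λ : Finset (Fin d → ℤ)) (x : Λ),
      ∑ y : Λ, Real.exp (-c * siteDist (y : Fin d → ℤ) x) ≤ W := by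
  classical
  -- The `ℓ¹` distance is at most `d` times the Euclidean one, so decay rate `b` per coordinate
  -- suffices; `d + 1` in the denominator covers `d = 0`.
  obtain ⟨b, hb, hbd⟩ : ∃ b : ℝ, 0 < b ∧ d * b ≤ c :=
    ⟨c / (d + 1), by positivity, by
      rw [← mul_div_assoc, div_le_iff₀ (by positivity)]
      nlinarith⟩
  have hs := summable_exp_neg_mul_abs_int hb
  have hpos : 0 < ∑' k : ℤ, Real.exp (-b * |(k : ℝ)|) :=
    hs.tsum_pos (fun k => (Real.exp_pos _).le) 0 (Real.exp_pos _)
  refine ⟨(∑' k : ℤ, Real.exp (-b * |(k : ℝ)|)) ^ d, by positivity, fun Λ x => ?_⟩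
  obtain ⟨x, hx⟩ := x
  rw [Finset.sum_coe_sort Λ fun y => Real.exp (-c * siteDist y x)]
  have h1 : ∀ y : Fin d → ℤ, Real.exp (-c * siteDist y x) ≤
      ∏ i, Real.exp (-b * |((y i - x i : ℤ) : ℝ)|) := fun y => by
    rw [← Real.exp_sum, ← Finset.mul_sum]
    refine Real.exp_le_exp.2 ?_
    have h2 : ∑ i, |((y i - x i : ℤ) : ℝ)| ≤ d * siteDist y x := by
      refine (Finset.sum_le_card_nsmul _ _ (siteDist y x) fun i _ => ?_).trans ?_
      · push_cast
        exact abs_sub_le_siteDist y x i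
      · simp
    nlinarith [siteDist_nonneg y x, mul_le_mul_of_nonneg_left h2 hb.le,
      mul_le_mul_of_nonneg_right hbd (siteDist_nonneg y x)]
  calc ∑ y ∈ Λ, Real.exp (-c * siteDist y x)
      ≤ ∑ y ∈ Λ, ∏ i, Real.exp (-b * |((y i - x i : ℤ) : ℝ)|) :=
        Finset.sum_le_sum fun y _ => h1 y
    -- Enlarging `Λ` to the product of its coordinate projections makes the sum factorise.
    _ ≤ ∑ y ∈ Fintype.piFinset fun i => Λ.image fun y => y i,
          ∏ i, Real.exp (-b * |((y i - x i : ℤ) : ℝ)|) :=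
        Finset.sum_le_sum_of_subset_of_nonneg
          (fun y hy => Fintype.mem_piFinset.2 fun i => Finset.mem_image_of_mem _ hy)
          fun y _ _ => Finset.prod_nonneg fun i _ => (Real.exp_pos _).le
    _ = ∏ i, ∑ k ∈ Λ.image fun y => y i, Real.exp (-b * |((k - x i : ℤ) : ℝ)|) :=
        (Finset.prod_univ_sum _ fun i k => Real.exp (-b * |((k - x i : ℤ) : ℝ)|)).symm
    _ ≤ ∏ _i : Fin d, ∑' k : ℤ, Real.exp (-b * |(k : ℝ)|) := by
        refine Finset.prod_le_prod
          (fun i _ => Finset.sum_nonneg fun k _ => (Real.exp_pos _).le) fun i _ => ?_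
        rw [← (Equiv.subRight (x i)).tsum_eq]
        exact ((Equiv.subRight (x i)).summable_iff.2 hs).sum_le_tsum _
          fun k _ => (Real.exp_pos _).le
    _ = _ := by simp

theorem exists_exp_neg_mul_le_rpow {b : ℝ} (hb : 0 < b) (θ : ℝ) :
    ∃ K : ℝ, 0 < K ∧ ∀ s : ℝ, 1 ≤ s → Real.exp (-(b * s)) ≤ K * s ^ (-θ) := by
  obtain ⟨k, hk⟩ := exists_nat_ge θ
  refine ⟨k.factorial / b ^ k, by positivity, fun s hs => ?_⟩
  have hs0 : 0 < s := by linarith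
  have h1 := Real.pow_div_factorial_le_exp (b * s) (by positivity) k
  have h2 : s ^ θ ≤ s ^ k := by
    rw [← Real.rpow_natCast]
    exact Real.rpow_le_rpow_of_exponent_le hs hk
  rw [Real.exp_neg, Real.rpow_neg hs0.le]
  calc (Real.exp (b * s))⁻¹ ≤ ((b * s) ^ k / k.factorial)⁻¹ := by gcongr
    _ = k.factorial / b ^ k * (s ^ k)⁻¹ := by rw [mul_pow]; field_simp
    _ ≤ _ := by gcongr

/-- Dividing by `a`, the left side tends to `c < u` as `a → 0`. A flat enough cutoff thus costs
arbitrarily little speed beyond `2d|J|`. -/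
theorem exists_slope {c u η : ℝ} (hcu : c < u) (hc : 0 ≤ c) :
    ∃ a : ℝ, 0 < a ∧ c * ((Real.exp a - 1) * Real.exp a ^ (η - 1)) ≤ a * u := by
  have hcont : ContinuousAt (fun a : ℝ => c * Real.exp (a * η)) 0 := by fun_prop
  have hev : ∀ᶠ a : ℝ in nhdsWithin 0 (Set.Ioi 0), c * Real.exp (a * η) < u :=
    nhdsWithin_le_nhds (hcont.eventually (gt_mem_nhds (by simpa using hcu)))
  obtain ⟨a, ha, ha0⟩ := (hev.and self_mem_nhdsWithin).exists
  have ha0 : 0 < a := ha0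
  refine ⟨a, ha0, ?_⟩
  have h1 : Real.exp a - 1 ≤ a * Real.exp a := by
    have h2 := Real.add_one_le_exp (-a)
    have h3 : Real.exp (-a) * Real.exp a = 1 := by rw [← Real.exp_add]; simp
    nlinarith [Real.exp_pos a]
  have h4 : Real.exp a * Real.exp a ^ (η - 1) = Real.exp (a * η) := by
    rw [← Real.exp_mul, ← Real.exp_add]; congr 1; ring
  calc c * ((Real.exp a - 1) * Real.exp a ^ (η - 1))
      ≤ c * ((a * Real.exp a) * Real.exp a ^ (η - 1)) := by gcongr
    _ = a * (c * Real.exp (a * η)) := by rw [← h4]; ring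
    _ ≤ a * u := by gcongr

/-! ### Powers of weighted sums -/

/-- Jensen's inequality for the normalised weights; a vanishing total weight is treated separately.
-/
theorem rpow_sum_mul_le {ι : Type*} {s : Finset ι} {w z : ι → ℝ} {W η : ℝ} (hη : 1 ≤ η)
    (hw : ∀ i ∈ s, 0 ≤ w i) (hz : ∀ i ∈ s, 0 ≤ z i) (hW : ∑ i ∈ s, w i ≤ W) :
    (∑ i ∈ s, w i * z i) ^ η ≤ W ^ (η - 1) * ∑ i ∈ s, w i * z i ^ η := by
  have hnn : 0 ≤ ∑ i ∈ s, w i * z i ^ η :=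
    Finset.sum_nonneg fun i hi => mul_nonneg (hw i hi) (Real.rpow_nonneg (hz i hi) _)
  rcases (Finset.sum_nonneg hw).eq_or_lt with h0 | h0
  · have h1 := (Finset.sum_eq_zero_iff_of_nonneg hw).1 h0.symm
    rw [Finset.sum_eq_zero fun i hi => by rw [h1 i hi, zero_mul], Real.zero_rpow (by linarith)]
    exact mul_nonneg (Real.rpow_nonneg (h0.le.trans hW) _) hnn
  · have h := Real.rpow_arith_mean_le_arith_mean_rpow s (fun i => w i / ∑ j ∈ s, w j) z
      (fun i hi => div_nonneg (hw i hi) h0.le) (by rw [← Finset.sum_div, div_self h0.ne']) hz hη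
    simp only [div_mul_eq_mul_div, ← Finset.sum_div] at h
    rw [Real.div_rpow (Finset.sum_nonneg fun i hi => mul_nonneg (hw i hi) (hz i hi)) h0.le,
      div_le_iff₀ (by positivity)] at h
    refine h.trans ?_
    rw [div_mul_eq_mul_div, mul_div_assoc, mul_comm, ← Real.rpow_sub_one h0.ne']
    gcongr

theorem rpow_add_le_two_rpow_mul {A B η : ℝ} (hη : 1 ≤ η) (hA : 0 ≤ A) (hB : 0 ≤ B) :
    (A + B) ^ η ≤ 2 ^ (η - 1) * (A ^ η + B ^ η) := by
  lift A to NNReal using hA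
  lift B to NNReal using hB
  exact_mod_cast NNReal.rpow_add_le_mul_rpow_add_rpow A B hη

/-! ### Traces against diagonal operators -/

theorem traceDiag_mono {d : ℕ} {Λ : Finset (Fin d → ℤ)} {ρ : Fock Λ →L[ℂ] Fock Λ}
    (hρ : ∀ n : Config Λ, 0 ≤ (inner ℂ (ket n) (ρ (ket n))).re) {f g : Config Λ → ℝ}
    (hfg : ∀ n, f n ≤ g n) : traceDiag f ρ ≤ traceDiag g ρ :=
  ENNReal.tsum_le_tsum fun n =>
    ENNReal.ofReal_le_ofReal (mul_le_mul_of_nonneg_right (hfg n) (hρ n))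

theorem traceDiag_add {d : ℕ} {Λ : Finset (Fin d → ℤ)} {ρ : Fock Λ →L[ℂ] Fock Λ}
    (hρ : ∀ n : Config Λ, 0 ≤ (inner ℂ (ket n) (ρ (ket n))).re) {f g : Config Λ → ℝ}
    (hf : ∀ n, 0 ≤ f n) (hg : ∀ n, 0 ≤ g n) :
    traceDiag (fun n => f n + g n) ρ = traceDiag f ρ + traceDiag g ρ := by
  simp only [traceDiag]
  rw [← ENNReal.tsum_add]
  refine tsum_congr fun n => ?_
  rw [add_mul, ENNReal.ofReal_add (mul_nonneg (hf n) (hρ n)) (mul_nonneg (hg n) (hρ n))]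

theorem traceDiag_const_mul {d : ℕ} {Λ : Finset (Fin d → ℤ)} (ρ : Fock Λ →L[ℂ] Fock Λ) {c : ℝ}
    (hc : 0 ≤ c) (f : Config Λ → ℝ) :
    traceDiag (fun n => c * f n) ρ = ENNReal.ofReal c * traceDiag f ρ := by
  simp only [traceDiag]
  rw [← ENNReal.tsum_mul_left]
  refine tsum_congr fun n => ?_
  rw [mul_assoc, ENNReal.ofReal_mul hc]

theorem traceDiag_sum {d : ℕ} {Λ : Finset (Fin d → ℤ)} {ρ : Fock Λ →L[ℂ] Fock Λ}
    (hρ : ∀ n : Config Λ, 0 ≤ (inner ℂ (ket n) (ρ (ket n))).re) {ι : Type*} (s : Finset ι)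
    {f : ι → Config Λ → ℝ} (hf : ∀ i n, 0 ≤ f i n) :
    traceDiag (fun n => ∑ i ∈ s, f i n) ρ = ∑ i ∈ s, traceDiag (f i) ρ := by
  simp only [traceDiag]
  rw [← Summable.tsum_finsetSum fun i _ => ENNReal.summable]
  refine tsum_congr fun n => ?_
  rw [Finset.sum_mul, ENNReal.ofReal_sum_of_nonneg fun i _ => mul_nonneg (hf i n) (hρ n)]

/-- The controlled density assumption enters only here, at radius `1` and exponent `η`. -/
theorem traceDiag_occupation_rpow_le {d : ℕ} {Λ : Finset (Fin d → ℤ)}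
    {ρ : Fock Λ →L[ℂ] Fock Λ} (hρ : ρ.IsPositive) {lam η : ℝ} (hη : 0 < η)
    (hcd : ControlledDensity lam η ρ) (y : Λ) :
    traceDiag (fun n => (n y : ℝ) ^ η) ρ ≤ ENNReal.ofReal (lam ^ η) := by
  have h := hcd 1 le_rfl y η hη le_rfl
  rw [one_pow, mul_one] at h
  refine (traceDiag_mono (re_inner_ket_nonneg hρ) fun n => ?_).trans h
  refine Real.rpow_le_rpow (Nat.cast_nonneg _) ?_ hη.le
  have hy : y ∈ ball y 1 := by simp [ball, siteDist]
  exact_mod_cast Finset.single_le_sum (f := n) (fun _ _ => Nat.zero_le _) hy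

/-! ### Comparison of the cutoffs with balls -/

theorem number_ball_rpow_le {d : ℕ} {Λ : Finset (Fin d → ℤ)} {a r η : ℝ} (ha : 0 ≤ a)
    (hη : 0 ≤ η) (x : Λ) (n : Config Λ) :
    (number (ball x r) n : ℝ) ^ η ≤ 2 ^ η *
      weightedNumber (fun y => Real.sigmoid (a * (r - siteDist (y : Fin d → ℤ) x))) n ^ η := by
  have hnn := weightedNumber_nonneg (Λ := Λ)
    (f := fun y => Real.sigmoid (a * (r - siteDist (y : Fin d → ℤ) x)))
    (fun _ => Real.sigmoid_nonneg _) n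
  rw [← Real.mul_rpow (by norm_num) hnn]
  refine Real.rpow_le_rpow (Nat.cast_nonneg _) ?_ hη
  rw [weightedNumber, Finset.mul_sum, number]
  push_cast
  refine (Finset.sum_le_sum fun y hy => ?_).trans
    (Finset.sum_le_sum_of_subset_of_nonneg (Finset.subset_univ (ball x r)) fun y _ _ =>
      mul_nonneg (by norm_num) (mul_nonneg (Real.sigmoid_nonneg _) (Nat.cast_nonneg _)))
  have hy' : siteDist (y : Fin d → ℤ) x ≤ r := (Finset.mem_filter.1 hy).2
  have h : Real.sigmoid 0 ≤ Real.sigmoid (a * (r - siteDist (y : Fin d → ℤ) x)) :=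
    Real.sigmoid_le (mul_nonneg ha (by linarith))
  rw [Real.sigmoid_zero] at h
  nlinarith [Nat.cast_nonneg (α := ℝ) (n y)]

/-- The exponent outside the ball is split in two: `e` is the uniform gain, while `c * D` makes the
sum over sites converge uniformly in `Λ`. -/
theorem weightedNumber_sigmoid_le {d : ℕ} {Λ : Finset (Fin d → ℤ)} {a w R e c : ℝ} (x : Λ)
    (h : ∀ D, R ≤ D → a * (w - D) ≤ -e + -c * D) (n : Config Λ) :
    weightedNumber (fun y => Real.sigmoid (a * (w - siteDist (y : Fin d → ℤ) x))) n ≤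
      number (ball x R) n +
        Real.exp (-e) * ∑ y : Λ, Real.exp (-c * siteDist (y : Fin d → ℤ) x) * n y := by
  classical
  have h1 : (number (ball x R) n : ℝ) = ∑ y : Λ, if y ∈ ball x R then (n y : ℝ) else 0 := by
    rw [number, Finset.sum_ite_mem, Finset.univ_inter]
    push_cast
    rfl
  rw [h1, Finset.mul_sum, ← Finset.sum_add_distrib]
  refine Finset.sum_le_sum fun y _ => ?_
  have hn : (0 : ℝ) ≤ n y := Nat.cast_nonneg _
  by_cases hy : y ∈ ball x R
  · rw [if_pos hy]
    have := Real.sigmoid_le_one (a * (w - siteDist (y : Fin d → ℤ) x))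
    have h2 : 0 ≤ Real.exp (-e) * (Real.exp (-c * siteDist (y : Fin d → ℤ) x) * n y) := by
      positivity
    nlinarith
  · rw [if_neg hy, zero_add, ← mul_assoc, ← Real.exp_add]
    have hD : R ≤ siteDist (y : Fin d → ℤ) x := by
      by_contra! hlt
      exact hy (Finset.mem_filter.2 ⟨Finset.mem_univ y, hlt.le⟩)
    gcongr
    exact (sigmoid_le_exp _).trans (Real.exp_le_exp.2 (h _ hD))

theorem traceDiag_weightedNumber_sigmoid_le {d : ℕ} {Λ : Finset (Fin d → ℤ)}
    {ρ : Fock Λ →L[ℂ] Fock Λ} (hρ : ρ.IsPositive) {lam η : ℝ} (hlam : 0 ≤ lam) (hη : 1 ≤ η)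
    (hcd : ControlledDensity lam η ρ) {a w R e c W : ℝ} (x : Λ)
    (h : ∀ D, R ≤ D → a * (w - D) ≤ -e + -c * D)
    (hW : ∑ y : Λ, Real.exp (-c * siteDist (y : Fin d → ℤ) x) ≤ W) :
    traceDiag (fun n =>
        weightedNumber (fun y => Real.sigmoid (a * (w - siteDist (y : Fin d → ℤ) x))) n ^ η) ρ ≤
      ENNReal.ofReal (2 ^ (η - 1)) * moment (ball x R) η ρ +
        ENNReal.ofReal (2 ^ (η - 1) * Real.exp (-(η * e)) * W ^ η * lam ^ η) := by
  have hη0 : 0 < η := by linarith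
  have hW0 : 0 ≤ W := (Finset.sum_nonneg fun y _ => (Real.exp_pos _).le).trans hW
  have hpt : ∀ n : Config Λ,
      weightedNumber (fun y => Real.sigmoid (a * (w - siteDist (y : Fin d → ℤ) x))) n ^ η ≤
        2 ^ (η - 1) * (number (ball x R) n : ℝ) ^ η +
          2 ^ (η - 1) * Real.exp (-(η * e)) * W ^ (η - 1) *
            ∑ y : Λ, Real.exp (-c * siteDist (y : Fin d → ℤ) x) * (n y : ℝ) ^ η := fun n => by
    have hB : 0 ≤ ∑ y : Λ, Real.exp (-c * siteDist (y : Fin d → ℤ) x) * (n y : ℝ) :=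
      Finset.sum_nonneg fun y _ => by positivity
    refine (Real.rpow_le_rpow (weightedNumber_nonneg (fun _ => Real.sigmoid_nonneg _) n)
      (weightedNumber_sigmoid_le x h n) hη0.le).trans ?_
    refine (rpow_add_le_two_rpow_mul hη (Nat.cast_nonneg _)
      (mul_nonneg (Real.exp_pos _).le hB)).trans ?_
    rw [Real.mul_rpow (Real.exp_pos _).le hB, ← Real.exp_mul, mul_add]
    have h1 := rpow_sum_mul_le (s := Finset.univ) hη
      (w := fun y : Λ => Real.exp (-c * siteDist (y : Fin d → ℤ) x)) (z := fun y => (n y : ℝ))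
      (fun y _ => (Real.exp_pos _).le) (fun y _ => Nat.cast_nonneg _) hW
    have h2 : -e * η = -(η * e) := by ring
    rw [h2]
    calc _ ≤ 2 ^ (η - 1) * (number (ball x R) n : ℝ) ^ η + 2 ^ (η - 1) * (Real.exp (-(η * e)) *
          (W ^ (η - 1) *
            ∑ y : Λ, Real.exp (-c * siteDist (y : Fin d → ℤ) x) * (n y : ℝ) ^ η)) := by gcongr
      _ = _ := by ring
  have hpos := re_inner_ket_nonneg hρ
  refine (traceDiag_mono hpos hpt).trans ?_
  rw [traceDiag_add hpos (fun n => by positivity) (fun n => by positivity),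
    traceDiag_const_mul _ (by positivity), traceDiag_const_mul _ (by positivity),
    traceDiag_sum hpos _ (fun y n => by positivity)]
  refine add_le_add le_rfl ?_
  have hsum : ∑ y : Λ, traceDiag
      (fun n => Real.exp (-c * siteDist (y : Fin d → ℤ) x) * (n y : ℝ) ^ η) ρ ≤
        ENNReal.ofReal (W * lam ^ η) := by
    calc _ ≤ ∑ y : Λ, ENNReal.ofReal (Real.exp (-c * siteDist (y : Fin d → ℤ) x) * lam ^ η) := by
          refine Finset.sum_le_sum fun y _ => ?_
          rw [traceDiag_const_mul _ (Real.exp_pos _).le, ENNReal.ofReal_mul (Real.exp_pos _).le]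
          gcongr
          exact traceDiag_occupation_rpow_le hρ hη0 hcd y
      _ = ENNReal.ofReal (∑ y : Λ, Real.exp (-c * siteDist (y : Fin d → ℤ) x) * lam ^ η) :=
          (ENNReal.ofReal_sum_of_nonneg fun y _ => by positivity).symm
      _ ≤ _ := by
          rw [← Finset.sum_mul]
          gcongr
  refine (mul_le_mul_right hsum _).trans ?_
  rw [← ENNReal.ofReal_mul (by positivity)]
  refine ENNReal.ofReal_le_ofReal (le_of_eq ?_)
  have hWη : W ^ η = W ^ (η - 1) * W := by
    conv_lhs => rw [show η = (η - 1) + 1 by ring]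
    rcases hW0.eq_or_lt with h0 | h0
    · rw [← h0, mul_zero, Real.zero_rpow (by linarith)]
    · exact Real.rpow_add_one h0.ne' _
  rw [hWη]
  ring

end BoseHubbard

/-! ### Choice of the parameters and conclusion. -/

theorem theorem3p1 (d : ℕ) (η J v δ₀ β : ℝ) (hη : 1 ≤ η) (hv : 2 * (d : ℝ) * |J| < v)
    (hδ₀ : 0 < δ₀) (hδ₀' : δ₀ < 1) (hβ : 1 ≤ β) :
    ∃ C : ℝ, 0 < C ∧
      ∀ (Λ : Finset (Fin d → ℤ)) (U μ p : ℝ), 1 ≤ p →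
      ∀ (lam : ℝ), 0 < lam →
      ∀ ρ : BoseHubbard.Fock Λ →L[ℂ] BoseHubbard.Fock Λ,
        BoseHubbard.IsState ρ → BoseHubbard.ControlledDensity lam η ρ →
      ∀ (x : Λ) (r R t : ℝ), 0 ≤ r → r < R → max 1 (δ₀ * r) < R - r → v * |t| ≤ R - r →
        BoseHubbard.moment (BoseHubbard.ball x r) η (BoseHubbard.evolve J U μ p t ρ) ≤
          ENNReal.ofReal C * BoseHubbard.moment (BoseHubbard.ball x R) η ρ +
            ENNReal.ofReal (C * lam ^ η * (R - r) ^ (-β + d * η)) := by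
  open BoseHubbard in
  have hJ : 0 ≤ 2 * (d : ℝ) * |J| := by positivity
  have hη0 : 0 < η := by linarith
  obtain ⟨u, hJu, huv⟩ := exists_between hv
  have hv0 : 0 < v := hJ.trans_lt hv
  have hu0 : 0 < u := hJ.trans_lt hJu
  obtain ⟨a, ha, hau⟩ := exists_slope (η := η) hJu hJ
  -- The initial cutoff radius `r + u * |t|` stays at least `κ * (R - r)` below `R`. Half of this
  -- margin becomes decay in `R - r`, the other half pays for `c * R`.
  obtain ⟨κ, hκ⟩ : ∃ κ, κ = 1 - u / v := ⟨_, rfl⟩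
  have huv1 : u / v < 1 := (div_lt_one hv0).2 huv
  have huv0 : 0 < u / v := by positivity
  have hκ0 : 0 < κ := by linarith
  have hκ1 : κ < 1 := by linarith
  -- The value for which `δ₀ * R ≤ (1 + δ₀) * (R - r)` gives `c * R ≤ κ / 2 * (R - r)`.
  obtain ⟨c, hc⟩ : ∃ c, c = κ / 2 * (δ₀ / (1 + δ₀)) := ⟨_, rfl⟩
  have hc0 : 0 < c := by rw [hc]; positivity
  have hcδ : c * (1 + δ₀) = κ / 2 * δ₀ := by rw [hc]; field_simp
  have hc1 : c ≤ 1 := by nlinarith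
  obtain ⟨W, hW0, hW⟩ := exists_sum_exp_neg_siteDist_le d (c := a * c) (by positivity)
  obtain ⟨K, hK0, hK⟩ :=
    exists_exp_neg_mul_le_rpow (b := η * (a * (κ / 2))) (by positivity) (β - d * η)
  -- `2 ^ η` comes from the cutoff being at least `1/2` on the small ball, `2 ^ (η - 1)` from
  -- separating the ball from the tail, `W ^ η * K` from the tail.
  refine ⟨2 ^ η * 2 ^ (η - 1) * (1 + W ^ η * K), by positivity, ?_⟩
  intro Λ U μ p _ lam hlam ρ hρ hcd x r R t hr hrR hmax hvt
  have hs1 : 1 < R - r := (le_max_left _ _).trans_lt hmax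
  have hsδ : δ₀ * r < R - r := (le_max_right _ _).trans_lt hmax
  have hut : u * |t| ≤ (1 - κ) * (R - r) := by
    have : u * |t| = u / v * (v * |t|) := by field_simp
    rw [this, hκ, sub_sub_cancel]
    gcongr
  have hcR : c * R ≤ κ / 2 * (R - r) := by
    have h1 : δ₀ * R ≤ (1 + δ₀) * (R - r) := by nlinarith
    have h2 : c * (δ₀ * R) ≤ c * ((1 + δ₀) * (R - r)) := by gcongr
    have h3 : δ₀ * (c * R) ≤ δ₀ * (κ / 2 * (R - r)) := by
      calc _ = c * (δ₀ * R) := by ring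
        _ ≤ _ := h2
        _ = (c * (1 + δ₀)) * (R - r) := by ring
        _ = _ := by rw [hcδ]; ring
    exact le_of_mul_le_mul_left h3 hδ₀
  have hexp : ∀ D, R ≤ D →
      a * (r + u * |t| - D) ≤ -(a * (κ / 2) * (R - r)) + -(a * c) * D := fun D hD => by
    -- At `D = R` this is `hut` and `hcR`; since `c ≤ 1`, it persists for larger `D`.
    have h1 : r + u * |t| - D ≤ -(κ / 2 * (R - r)) - c * D := by
      nlinarith [mul_nonneg (sub_nonneg.2 hc1) (sub_nonneg.2 hD)]
    calc _ ≤ a * (-(κ / 2 * (R - r)) - c * D) := by gcongr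
      _ = _ := by ring
  have hD : ∀ y z : Λ, Neighbor (y : Fin d → ℤ) z →
      |siteDist (y : Fin d → ℤ) x - siteDist (z : Fin d → ℤ) x| ≤ 1 := fun y z hyz =>
    (abs_siteDist_sub_le _ _ _).trans (le_of_eq hyz)
  have hdyn := traceDiag_weightedNumber_evolve_le hρ.isPositive J U μ p hη ha.le hau hD
    (r + u * |t|) t
  simp only [add_sub_cancel_right] at hdyn
  have h0 := traceDiag_weightedNumber_sigmoid_le hρ.isPositive hlam.le hη hcd x hexp (hW Λ x)
  have hfin : moment (ball x r) η (evolve J U μ p t ρ) ≤ ENNReal.ofReal (2 ^ η) *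
      traceDiag (fun n => weightedNumber (fun y : Λ =>
        Real.sigmoid (a * (r - siteDist (y : Fin d → ℤ) x))) n ^ η) (evolve J U μ p t ρ) := by
    rw [← traceDiag_const_mul _ (by positivity)]
    exact traceDiag_mono (re_inner_ket_evolve_nonneg hρ.isPositive J U μ p t)
      (number_ball_rpow_le ha.le hη0.le x)
  refine (hfin.trans (mul_le_mul_right (hdyn.trans h0) _)).trans ?_
  have hKs := hK (R - r) hs1.le
  rw [mul_add, ← mul_assoc, ← ENNReal.ofReal_mul (by positivity),
    ← ENNReal.ofReal_mul (by positivity)]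
  have hWK : 0 ≤ W ^ η * K := by positivity
  refine add_le_add (mul_le_mul_left (ENNReal.ofReal_le_ofReal ?_) _)
    (ENNReal.ofReal_le_ofReal ?_)
  · exact le_mul_of_one_le_right (by positivity) (by linarith)
  · have e1 : -(η * (a * (κ / 2) * (R - r))) = -(η * (a * (κ / 2)) * (R - r)) := by ring
    have e2 : -(β - d * η) = -β + d * η := by ring
    rw [e1]
    rw [e2] at hKs
    have hR : 0 ≤ (R - r) ^ (-β + d * η) := Real.rpow_nonneg (by linarith) _
    calc _ ≤ 2 ^ η * (2 ^ (η - 1) * (K * (R - r) ^ (-β + d * η)) * W ^ η * lam ^ η) := by gcongr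
      _ = 2 ^ η * 2 ^ (η - 1) * (W ^ η * K) * lam ^ η * (R - r) ^ (-β + d * η) := by ring
      _ ≤ _ := by
        gcongr
        linarith
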